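/- Let $p>1$ be an integer (not necessarily prime) and let $L$ be a non-split link admitting non-trivial $p$-colorings. Here a $p$-coloring of a diagram of $L$ is an assignment of integers mod $p$ (colors) to the arcs of the diagram such that, at every crossing, twice the color of the over-arc equals the sum of the colors of the two under-arcs; it is non-trivial if it uses more than one color. Let $\mathrm{Spec}_p L$ be the set of positive integers $n$ such that some diagram of $L$ has a non-trivial $p$-coloring using exactly $n$ distinct colors. Let $\mathrm{mincol}_p L$ and $\mathrm{maxcol}_p L$ be the minimum and the maximum number of distinct colors used by a non-trivial $p$-coloring of a diagram of $L$, over all diagrams of $L$; a non-trivial $p$-coloring of a diagram of $L$ is minimal if it uses exactly $\mathrm{mincol}_p L$ colors. 1. If some diagram of $L$ has a minimal non-trivial $p$-coloring with a crossing whose over-arc is colored $1$ and whose under-arcs are colored $0$ and $2$ (mod $p$), then \[ \mathrm{Spec}_p L=\{\mathrm{mincol}_p L,\ 1+\mathrm{mincol}_p L,\ 2+\mathrm{mincol}_p L,\ \dots,\ \mathrm{maxcol}_p L\}. \] 2. If some diagram of $L$ has a minimal non-trivial $p$-coloring with a crossing whose over-arc is colored $b$ and whose under-arcs are colored $a$ and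 $2b-a$, where $b-a$ is invertible mod $p$, then the same equality holds. -/

import Mathlib

open Filter Topology

/-- Euclidean 3-space. -/
abbrev Space : Type := EuclideanSpace ℝ (Fin 3)

/-- A (tame, unoriented) link, in its polygonal form: a nonempty compact subset of 3-space which
near each of its points `x` is the union of two distinct rays issuing from `x` (`¬ SameRay` forces
`d₁` and `d₂` to be nonzero and not positively proportional; they are opposite at an interior point
of an edge). By compactness this says exactly that the set is a finite disjoint union of simple
closed polygons. -/
structure Link where
  /-- the underlying set of points -/
  carrier : Set Space
  nonempty : carrier.Nonempty
  isCompact : IsCompact carrier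
  locally_two_rays : ∀ x ∈ carrier, ∃ d₁ d₂ : Space, ¬ SameRay ℝ d₁ d₂ ∧
    ∀ᶠ y in 𝓝 x, y ∈ carrier ↔ ∃ t : ℝ, 0 ≤ t ∧ (y = x + t • d₁ ∨ y = x + t • d₂)

namespace Link

/-- The elementary (triangle) move: a nondegenerate triangle `u v w` meets `K` exactly in its side
`[u, v]`, and this side is replaced by the two other sides `[u, w]` and `[w, v]`. -/
def TriangleMove (K K' : Link) : Prop :=
  ∃ u v w : Space, AffineIndependent ℝ ![u, v, w] ∧
    convexHull ℝ {u, v, w} ∩ K.carrier = segment ℝ u v ∧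
    K'.carrier = (K.carrier \ segment ℝ u v) ∪ (segment ℝ u w ∪ segment ℝ w v)

/-- Equivalence of links: a finite sequence of triangle moves and their inverses. -/
def Equivalent : Link → Link → Prop := Relation.EqvGen TriangleMove

/-- A split link is a link which can be moved so as to be contained in two disjoint balls, meeting
both of them. -/
def IsSplit (L : Link) : Prop :=
  ∃ L' : Link, L.Equivalent L' ∧ ∃ (x y : Space) (r s : ℝ),
    Disjoint (Metric.closedBall x r) (Metric.closedBall y s) ∧
    L'.carrier ⊆ Metric.closedBall x r ∪ Metric.closedBall y s ∧
    (L'.carrier ∩ Metric.closedBall x r).Nonempty ∧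
    (L'.carrier ∩ Metric.closedBall y s).Nonempty

/-- Near `x`, the link is the straight line through `x` with direction `d`. -/
def StraightAt (K : Link) (x d : Space) : Prop :=
  ∀ᶠ y in 𝓝 x, y ∈ K.carrier ↔ ∃ t : ℝ, y = x + t • d

end Link

/-- The vertical projection of 3-space to the plane; the third coordinate is the height. -/
def proj (x : Space) : EuclideanSpace ℝ (Fin 2) := !₂[x 0, x 1]

/-- A link diagram: a polygonal link whose vertical projection is regular, that is, has finitely
many multiple points, all of them double points at which (the interiors of) two edges cross
transversally. The heights tell which strand passes over the other at a crossing. -/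
structure Diagram where
  /-- the link that is projected -/
  toLink : Link
  finite_multiple : {x ∈ toLink.carrier | ∃ y ∈ toLink.carrier, y ≠ x ∧ proj y = proj x}.Finite
  double : ∀ x ∈ toLink.carrier, ∀ y ∈ toLink.carrier, ∀ z ∈ toLink.carrier,
    proj x = proj y → proj y = proj z → x = y ∨ y = z ∨ x = z
  transverse : ∀ x ∈ toLink.carrier, ∀ y ∈ toLink.carrier, x ≠ y → proj x = proj y →
    ∃ d e : Space, toLink.StraightAt x d ∧ toLink.StraightAt y e ∧
      LinearIndependent ℝ ![proj d, proj e]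

namespace Diagram

/-- `D` is a diagram of the link `L`. -/
def IsDiagramOf (D : Diagram) (L : Link) : Prop := L.Equivalent D.toLink

/-- At a crossing, the point `o` of the link lies over the point `u` of the link. -/
def Over (D : Diagram) (o u : Space) : Prop :=
  o ∈ D.toLink.carrier ∧ u ∈ D.toLink.carrier ∧ proj o = proj u ∧ u 2 < o 2

/-- The link with the undercrossing points removed. -/
def strands (D : Diagram) : Set Space :=
  {x ∈ D.toLink.carrier | ¬ ∃ o, D.Over o x}

/-- The arcs of the diagram: the connected components of what remains of the link when the
undercrossing points are removed. -/
abbrev Arc (D : Diagram) : Type := ConnectedComponents D.strands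

/-- The point `x` of the link lies on the arc `A` (and is not an undercrossing point). -/
def OnArc (D : Diagram) (x : Space) (A : D.Arc) : Prop :=
  ∃ h : x ∈ D.strands, ConnectedComponents.mk (⟨x, h⟩ : D.strands) = A

/-- There is a crossing of the diagram whose over-arc is `B` and whose two under-arcs, on the two
sides of the undercrossing point `u`, are `A` and `C` (possibly equal). -/
def CrossingArcs (D : Diagram) (A B C : D.Arc) : Prop :=
  ∃ o u : Space, D.Over o u ∧ D.OnArc o B ∧
    ∃ d : Space, ∀ᶠ t in 𝓝[>] (0 : ℝ), D.OnArc (u - t • d) A ∧ D.OnArc (u + t • d) C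

/-- A Fox `p`-coloring: an assignment of integers mod `p` to the arcs such that at each crossing
twice the color of the over-arc is the sum of the colors of the under-arcs. -/
structure Coloring (D : Diagram) (p : ℕ) where
  /-- the color of an arc -/
  color : D.Arc → ZMod p
  condition : ∀ A B C : D.Arc, D.CrossingArcs A B C → 2 * color B = color A + color C

namespace Coloring

variable {D : Diagram} {p : ℕ}

/-- A non-trivial coloring uses more than one color. -/
def IsNontrivial (c : D.Coloring p) : Prop := ∃ A B : D.Arc, c.color A ≠ c.color B

/-- The number of distinct colors used. -/
noncomputable def numColors (c : D.Coloring p) : ℕ := (Set.range c.color).ncard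

/-- The coloring has a crossing whose over-arc is colored `y` and whose under-arcs are colored `x`
and `z`. -/
def HasCrossing (c : D.Coloring p) (x y z : ZMod p) : Prop :=
  ∃ A B C : D.Arc, D.CrossingArcs A B C ∧ c.color A = x ∧ c.color B = y ∧ c.color C = z

end Coloring

/-- The numbers of colors used by the non-trivial `p`-colorings of the diagram. -/
def colorNumbers (D : Diagram) (p : ℕ) : Set ℕ :=
  {n | ∃ c : D.Coloring p, c.IsNontrivial ∧ c.numColors = n}

end Diagram

namespace Link

/-- The link admits non-trivial `p`-colorings. -/
def HasNontrivialColoring (L : Link) (p : ℕ) : Prop :=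
  ∃ D : Diagram, D.IsDiagramOf L ∧ ∃ c : D.Coloring p, c.IsNontrivial

/-- The minimum over the (colorable) diagrams `D` of `L` of the minimum number of colors in a
non-trivial `p`-coloring of `D`. -/
noncomputable def mincol (L : Link) (p : ℕ) : ℕ :=
  sInf {m | ∃ D : Diagram, D.IsDiagramOf L ∧ (D.colorNumbers p).Nonempty ∧
    m = sInf (D.colorNumbers p)}

/-- The maximum over the (colorable) diagrams `D` of `L` of the maximum number of colors in a
non-trivial `p`-coloring of `D`. -/
noncomputable def maxcol (L : Link) (p : ℕ) : ℕ :=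
  sSup {m | ∃ D : Diagram, D.IsDiagramOf L ∧ (D.colorNumbers p).Nonempty ∧
    m = sSup (D.colorNumbers p)}

/-- The spectrum of `L` mod `p`: the numbers of colors used by the non-trivial `p`-colorings of the
diagrams of `L`. -/
def Spec (L : Link) (p : ℕ) : Set ℕ :=
  {n | ∃ D : Diagram, D.IsDiagramOf L ∧ n ∈ D.colorNumbers p}

/-- `c` is a minimal non-trivial `p`-coloring for the link `L`, on the diagram `D` of `L`. -/
def IsMinimalColoring (L : Link) {p : ℕ} {D : Diagram} (c : D.Coloring p) : Prop :=
  D.IsDiagramOf L ∧ c.IsNontrivial ∧ c.numColors = L.mincol p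

end Link

/-! The engine is a Reidemeister II move that creates one prescribed color. At a crossing with
over-color `y` and an under-arc colored `z`, pull a piece of that under-arc over the neighboring
part of the over-strand. The detour keeps the color `z`, the short piece of over-strand below it
must receive `2 * z - y`, and everything else keeps its color. No old color disappears, and one of
the new crossings is colored `y`, `z`, `2 * z - y` (`Diagram.Coloring.HasCrossing.exists_coloring`).

Starting at `0, 1, 2`, iteration yields crossings `k, k + 1, k + 2`, each step inserting the color
`k + 3`. The number of colors grows by at most one per step and the process ends with all `p`
residues in use, so every number from `mincol` up to `p` is attained (`exists_numColors_eq`). As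
`maxcol ≤ p`, the whole interval lies in the spectrum; the other inclusion is formal. When `b - a`
is a unit, an affine bijection of the colors carries `a, b, 2 * b - a` to `0, 1, 2`.

Most of the work is geometric. A crossing is put into coordinates where both strands are straight
lines alone in a vertical column (`exists_crossingBox`); there a single explicit triangle move
performs the Reidemeister move. Colorings are handled as locally constant functions on points
(`ofFun`), which avoids describing the arcs of the new diagram. -/

/-! ### Projection, segments and rays. -/

theorem proj_add (x y : Space) : proj (x + y) = proj x + proj y := by
  ext i; fin_cases i <;> simp [proj]

theorem proj_smul (r : ℝ) (x : Space) : proj (r • x) = r • proj x := by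
  ext i; fin_cases i <;> simp [proj]

theorem proj_sub (x y : Space) : proj (x - y) = proj x - proj y := by
  ext i; fin_cases i <;> simp [proj]

theorem continuous_proj : Continuous proj :=
  LinearMap.continuous_of_finiteDimensional
    ({ toFun := proj, map_add' := proj_add, map_smul' := proj_smul } :
      Space →ₗ[ℝ] EuclideanSpace ℝ (Fin 2))

section Segments

variable {E : Type*} [NormedAddCommGroup E] [NormedSpace ℝ E]

theorem mem_segment_iff_exists {p q y : E} :
    y ∈ segment ℝ p q ↔ ∃ t : ℝ, 0 ≤ t ∧ t ≤ 1 ∧ y = p + t • (q - p) := by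
  rw [segment_eq_image']
  constructor
  · rintro ⟨t, ⟨h0, h1⟩, rfl⟩; exact ⟨t, h0, h1, rfl⟩
  · rintro ⟨t, h0, h1, rfl⟩; exact ⟨t, ⟨h0, h1⟩, rfl⟩

theorem mem_openSegment_iff_exists {p q y : E} :
    y ∈ openSegment ℝ p q ↔ ∃ t : ℝ, 0 < t ∧ t < 1 ∧ y = p + t • (q - p) := by
  rw [openSegment_eq_image']
  constructor
  · rintro ⟨t, ⟨h0, h1⟩, rfl⟩; exact ⟨t, h0, h1, rfl⟩
  · rintro ⟨t, h0, h1, rfl⟩; exact ⟨t, ⟨h0, h1⟩, rfl⟩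

theorem isClosed_segment' (p q : E) : IsClosed (segment ℝ p q) := by
  rw [segment_eq_image']
  exact (isCompact_Icc.image (by fun_prop)).isClosed

theorem isCompact_segment' (p q : E) : IsCompact (segment ℝ p q) := by
  rw [segment_eq_image']
  exact isCompact_Icc.image (by fun_prop)

/-- Near an endpoint, a segment is a ray. -/
theorem eventually_mem_segment_left {p q : E} (h : p ≠ q) :
    ∀ᶠ y in 𝓝 p, y ∈ segment ℝ p q ↔ ∃ t : ℝ, 0 ≤ t ∧ y = p + t • (q - p) := by
  have hn : 0 < ‖q - p‖ := norm_pos_iff.2 (sub_ne_zero.2 h.symm)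
  filter_upwards [Metric.ball_mem_nhds p hn] with y hy
  rw [mem_segment_iff_exists]
  constructor
  · rintro ⟨t, h0, -, rfl⟩; exact ⟨t, h0, rfl⟩
  · rintro ⟨t, h0, rfl⟩
    refine ⟨t, h0, ?_, rfl⟩
    rw [mem_ball_iff_norm, add_sub_cancel_left, norm_smul, Real.norm_of_nonneg h0] at hy
    nlinarith

/-- Near an interior point, a segment is a line. -/
theorem eventually_mem_segment_of_mem_openSegment {p q x : E} (h : p ≠ q)
    (hx : x ∈ openSegment ℝ p q) :
    ∀ᶠ y in 𝓝 x, y ∈ segment ℝ p q ↔ ∃ t : ℝ, y = x + t • (q - p) := by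
  have hn : 0 < ‖q - p‖ := norm_pos_iff.2 (sub_ne_zero.2 h.symm)
  obtain ⟨s, hs0, hs1, rfl⟩ := mem_openSegment_iff_exists.1 hx
  have hr : 0 < min s (1 - s) * ‖q - p‖ := mul_pos (lt_min hs0 (by linarith)) hn
  filter_upwards [Metric.ball_mem_nhds _ hr] with y hy
  rw [mem_segment_iff_exists]
  constructor
  · rintro ⟨t, h0, h1, rfl⟩; exact ⟨t - s, by module⟩
  · rintro ⟨t, rfl⟩
    rw [mem_ball_iff_norm, add_sub_cancel_left, norm_smul, Real.norm_eq_abs] at hy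
    have ht := lt_of_mul_lt_mul_right hy hn.le
    obtain ⟨h1, h2⟩ := lt_min_iff.1 ht
    obtain ⟨h3, h4⟩ := abs_lt.1 h1
    obtain ⟨h5, h6⟩ := abs_lt.1 h2
    exact ⟨s + t, by linarith, by linarith, by module⟩

end Segments

theorem LinearIndependent.pair_unique {E : Type*} [AddCommGroup E] [Module ℝ E] {p q : E}
    (h : LinearIndependent ℝ ![p, q]) {a b a' b' : ℝ}
    (he : a • p + b • q = a' • p + b' • q) : a = a' ∧ b = b' := by
  have := LinearIndependent.pair_iff.1 h (a - a') (b - b') (by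
    rw [← sub_eq_zero] at he; rw [← he]; module)
  exact ⟨sub_eq_zero.1 this.1, sub_eq_zero.1 this.2⟩

theorem not_sameRay_of_linearIndependent {E : Type*} [AddCommGroup E] [Module ℝ E] {p q : E}
    (h : LinearIndependent ℝ ![p, q]) : ¬ SameRay ℝ p q := by
  intro hs
  rcases hs with h0 | h0 | ⟨r, s, hr, hs, he⟩
  · exact h.ne_zero 0 h0
  · exact h.ne_zero 1 h0
  · have := h.pair_unique (a := r) (b := 0) (a' := 0) (b' := s) (by simpa using he)
    exact hr.ne' this.1

theorem not_sameRay_neg_self {E : Type*} [AddCommGroup E] [Module ℝ E] {p : E}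
    (h : p ≠ 0) : ¬ SameRay ℝ p (-p) := by
  intro hs
  exact h (eq_zero_of_sameRay_self_neg hs)

/-! ### Triangle moves inside an edge produce links. -/

namespace Link

/-- The set obtained from a link by replacing the side `[u, v]` of a triangle `u v w` by the two
other sides. -/
def replaceSide (K : Link) (u v w : Space) : Set Space :=
  (K.carrier \ segment ℝ u v) ∪ (segment ℝ u w ∪ segment ℝ w v)

/-- The triangle `u v w` is nondegenerate and meets `K` exactly in the side `[u, v]`, which is
strictly inside of an edge of `K`. -/
structure IsReplaceable (K : Link) (u v w : Space) : Prop where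
  indep : LinearIndependent ℝ ![v - u, w - u]
  hull_inter : convexHull ℝ {u, v, w} ∩ K.carrier = segment ℝ u v
  straight : ∀ x ∈ segment ℝ u v, K.StraightAt x (v - u)

variable {K : Link} {u v w : Space}

theorem replaceSide_symm (K : Link) (u v w : Space) :
    K.replaceSide u v w = K.replaceSide v u w := by
  rw [replaceSide, replaceSide, segment_symm ℝ u v, segment_symm ℝ u w, segment_symm ℝ w v,
    Set.union_comm (segment ℝ w u)]

namespace IsReplaceable

theorem symm (h : K.IsReplaceable u v w) : K.IsReplaceable v u w where
  indep := by
    rw [LinearIndependent.pair_iff]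
    intro s t hst
    have := LinearIndependent.pair_iff.1 h.indep (-s - t) t (by rw [← hst]; module)
    exact ⟨by linarith [this.1, this.2], this.2⟩
  hull_inter := by
    rw [Set.insert_comm, h.hull_inter, segment_symm]
  straight := fun x hx => by
    rw [segment_symm] at hx
    filter_upwards [h.straight x hx] with y hy
    rw [hy]
    exact ⟨fun ⟨t, ht⟩ => ⟨-t, by rw [ht]; module⟩, fun ⟨t, ht⟩ => ⟨-t, by rw [ht]; module⟩⟩

theorem ne (h : K.IsReplaceable u v w) : u ≠ v := by
  rintro rfl
  exact h.indep.ne_zero 0 (by simp)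

theorem ne_apex (h : K.IsReplaceable u v w) : u ≠ w := by
  rintro rfl
  exact h.indep.ne_zero 1 (by simp)

theorem segment_subset (h : K.IsReplaceable u v w) : segment ℝ u v ⊆ K.carrier :=
  h.hull_inter ▸ Set.inter_subset_right

theorem side_inter_segment (h : K.IsReplaceable u v w) {x : Space}
    (hx : x ∈ segment ℝ u w) (hx' : x ∈ segment ℝ u v) : x = u := by
  obtain ⟨s, -, -, rfl⟩ := mem_segment_iff_exists.1 hx
  obtain ⟨t, -, -, ht⟩ := mem_segment_iff_exists.1 hx'
  have := h.indep.pair_unique (a := 0) (b := s) (a' := t) (b' := 0)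
    (by simpa using add_left_cancel ht)
  simp [this.2]

theorem side_inter_side (h : K.IsReplaceable u v w) {x : Space}
    (hx : x ∈ segment ℝ u w) (hx' : x ∈ segment ℝ w v) : x = w := by
  obtain ⟨s, -, -, rfl⟩ := mem_segment_iff_exists.1 hx
  obtain ⟨t, -, -, ht⟩ := mem_segment_iff_exists.1 hx'
  have := h.indep.pair_unique (a := 0) (b := s) (a' := t) (b' := 1 - t) (by
    have : s • (w - u) = w + t • (v - w) - u := by rw [← ht]; module
    rw [zero_smul, zero_add, this]; module)
  have hs : s = 1 := by linarith [this.1, this.2]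
  simp [hs]

theorem side_inter_carrier (h : K.IsReplaceable u v w) {x : Space}
    (hx : x ∈ segment ℝ u w) (hK : x ∈ K.carrier) : x = u := by
  refine h.side_inter_segment hx ?_
  rw [← h.hull_inter]
  refine ⟨(convex_convexHull ℝ _).segment_subset ?_ ?_ hx, hK⟩ <;>
    exact subset_convexHull _ _ (by simp)

theorem apex_notMem (h : K.IsReplaceable u v w) : w ∉ K.carrier := fun hw =>
  h.ne_apex (h.side_inter_carrier (right_mem_segment ℝ u w) hw).symm

/-- Away from the two new sides, the new link coincides with the old one. -/
theorem eventually_iff_of_notMem {x : Space} (hx : x ∉ segment ℝ u v)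
    (hx' : x ∉ segment ℝ u w ∪ segment ℝ w v) :
    ∀ᶠ y in 𝓝 x, y ∈ K.replaceSide u v w ↔ y ∈ K.carrier := by
  filter_upwards [(isClosed_segment' u v).isOpen_compl.mem_nhds hx,
    ((isClosed_segment' u w).union (isClosed_segment' w v)).isOpen_compl.mem_nhds hx'] with y h1 h2
  constructor
  · rintro (h | h)
    · exact h.1
    · exact absurd h h2
  · exact fun h => Or.inl ⟨h, h1⟩

theorem eventually_iff_of_notMem_carrier {x : Space} (hx : x ∉ K.carrier) :
    ∀ᶠ y in 𝓝 x, y ∈ K.replaceSide u v w ↔ y ∈ segment ℝ u w ∪ segment ℝ w v := by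
  filter_upwards [K.isCompact.isClosed.isOpen_compl.mem_nhds hx] with y h1
  exact ⟨fun h => h.resolve_left fun h => h1 h.1, Or.inr⟩

/-- Being closed, both avoided sets stay away from a neighborhood of `x`, so that only the side `[u,
w]` is seen there. -/
theorem notMem_of_mem_openSegment (h : K.IsReplaceable u v w) {x : Space}
    (hx : x ∈ openSegment ℝ u w) : x ∉ K.carrier ∧ x ∉ segment ℝ w v := by
  obtain ⟨s, hs0, hs1, he⟩ := mem_openSegment_iff_exists.1 hx
  have hne : w - u ≠ 0 := h.indep.ne_zero 1
  constructor
  · intro hK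
    have := h.side_inter_carrier (openSegment_subset_segment _ _ _ hx) hK
    rw [this, left_eq_add, smul_eq_zero] at he
    exact he.elim hs0.ne' hne
  · intro hK
    have := h.side_inter_side (openSegment_subset_segment _ _ _ hx) hK
    rw [this] at he
    have : (1 - s) • (w - u) = 0 := by
      have h2 : w - u = s • (w - u) := by nth_rewrite 1 [he]; module
      rw [sub_smul, one_smul, ← h2, sub_self]
    rcases smul_eq_zero.1 this with h0 | h0
    · linarith
    · exact hne h0

theorem eventually_of_mem_openSegment (h : K.IsReplaceable u v w) {x : Space}
    (hx : x ∈ openSegment ℝ u w) :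
    ∀ᶠ y in 𝓝 x, y ∈ K.replaceSide u v w ↔ ∃ t : ℝ, y = x + t • (w - u) := by
  obtain ⟨h1, h2⟩ := h.notMem_of_mem_openSegment hx
  filter_upwards [eventually_iff_of_notMem_carrier h1,
    eventually_mem_segment_of_mem_openSegment h.ne_apex hx,
    (isClosed_segment' w v).isOpen_compl.mem_nhds h2] with y h3 h4 h5
  rw [h3, ← h4]
  exact ⟨fun h => h.resolve_right h5, Or.inl⟩

/-- Since `K` is straight at `u`, deleting `[u, v]` leaves the ray along `u - v`, and the new side
contributes the ray along `w - u`; nondegeneracy of the triangle makes these independent. -/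
theorem two_rays_left (h : K.IsReplaceable u v w) :
    ∃ d₁ d₂ : Space, ¬ SameRay ℝ d₁ d₂ ∧ ∀ᶠ y in 𝓝 u,
      y ∈ K.replaceSide u v w ↔ ∃ t : ℝ, 0 ≤ t ∧ (y = u + t • d₁ ∨ y = u + t • d₂) := by
  have hu : u ∉ segment ℝ w v := fun hu =>
    h.ne_apex (h.side_inter_side (left_mem_segment ℝ u w) hu)
  refine ⟨u - v, w - u, ?_, ?_⟩
  · apply not_sameRay_of_linearIndependent
    rw [LinearIndependent.pair_iff]
    intro s t hst
    have := LinearIndependent.pair_iff.1 h.indep (-s) t (by rw [← hst]; module)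
    exact ⟨by linarith [this.1], this.2⟩
  · filter_upwards [h.straight u (left_mem_segment ℝ u v), eventually_mem_segment_left h.ne,
      eventually_mem_segment_left h.ne_apex,
      (isClosed_segment' w v).isOpen_compl.mem_nhds hu] with y h1 h2 h3 h4
    constructor
    · rintro (⟨h5, h6⟩ | h5 | h5)
      · obtain ⟨t, rfl⟩ := h1.1 h5
        refine ⟨-t, ?_, Or.inl (by module)⟩
        by_contra ht
        exact h6 (h2.2 ⟨t, by linarith, rfl⟩)
      · obtain ⟨t, ht, rfl⟩ := h3.1 h5
        exact ⟨t, ht, Or.inr rfl⟩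
      · exact absurd h5 h4
    · rintro ⟨t, ht, rfl | rfl⟩
      · rcases ht.eq_or_lt with rfl | ht
        · right; left; simpa using left_mem_segment ℝ u w
        · left
          refine ⟨h1.2 ⟨-t, by module⟩, fun h5 => ?_⟩
          obtain ⟨s, hs, he⟩ := h2.1 h5
          have : (s + t) • (v - u) = 0 := by
            have := add_left_cancel he
            rw [add_smul, ← this]; module
          have := (smul_eq_zero.1 this).resolve_right (h.indep.ne_zero 0)
          linarith
      · right; left; exact h3.2 ⟨t, ht, rfl⟩

theorem two_rays_apex (h : K.IsReplaceable u v w) :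
    ∃ d₁ d₂ : Space, ¬ SameRay ℝ d₁ d₂ ∧ ∀ᶠ y in 𝓝 w,
      y ∈ K.replaceSide u v w ↔ ∃ t : ℝ, 0 ≤ t ∧ (y = w + t • d₁ ∨ y = w + t • d₂) := by
  refine ⟨u - w, v - w, ?_, ?_⟩
  · apply not_sameRay_of_linearIndependent
    rw [LinearIndependent.pair_iff]
    intro s t hst
    have := LinearIndependent.pair_iff.1 h.indep t (-s - t) (by rw [← hst]; module)
    exact ⟨by linarith [this.1, this.2], this.1⟩
  · filter_upwards [eventually_iff_of_notMem_carrier h.apex_notMem,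
      eventually_mem_segment_left h.ne_apex.symm,
      eventually_mem_segment_left h.symm.ne_apex.symm] with y h1 h2 h3
    rw [h1, Set.mem_union, segment_symm, h2, h3]
    constructor
    · rintro (⟨t, ht, rfl⟩ | ⟨t, ht, rfl⟩)
      exacts [⟨t, ht, Or.inl rfl⟩, ⟨t, ht, Or.inr rfl⟩]
    · rintro ⟨t, ht, rfl | rfl⟩
      exacts [Or.inl ⟨t, ht, rfl⟩, Or.inr ⟨t, ht, rfl⟩]

theorem two_rays_of_mem_side (h : K.IsReplaceable u v w) {x : Space}
    (hx : x ∈ segment ℝ u w) :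
    ∃ d₁ d₂ : Space, ¬ SameRay ℝ d₁ d₂ ∧ ∀ᶠ y in 𝓝 x,
      y ∈ K.replaceSide u v w ↔ ∃ t : ℝ, 0 ≤ t ∧ (y = x + t • d₁ ∨ y = x + t • d₂) := by
  rw [← insert_endpoints_openSegment] at hx
  rcases hx with rfl | rfl | hx
  · exact h.two_rays_left
  · exact h.two_rays_apex
  · refine ⟨w - u, -(w - u), not_sameRay_neg_self (h.indep.ne_zero 1), ?_⟩
    filter_upwards [h.eventually_of_mem_openSegment hx] with y hy
    rw [hy]
    constructor
    · rintro ⟨t, rfl⟩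
      rcases le_total 0 t with ht | ht
      · exact ⟨t, ht, Or.inl rfl⟩
      · exact ⟨-t, by linarith, Or.inr (by module)⟩
    · rintro ⟨t, ht, rfl | rfl⟩
      · exact ⟨t, rfl⟩
      · exact ⟨-t, by module⟩

/-- The link obtained by a triangle move. -/
def newLink (h : K.IsReplaceable u v w) : Link where
  carrier := K.replaceSide u v w
  nonempty := ⟨u, Or.inr (Or.inl (left_mem_segment ℝ u w))⟩
  isCompact := by
    -- The endpoints `u`, `v` belong to the new sides, so it is harmless to delete only the open
    -- segment; what remains of `K` is then closed.
    have : K.replaceSide u v w =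
        (K.carrier \ (openSegment ℝ u v)) ∪ (segment ℝ u w ∪ segment ℝ w v) := by
      rw [replaceSide, ← insert_endpoints_openSegment ℝ u v]
      ext y
      have h1 := left_mem_segment ℝ u w
      have h2 := right_mem_segment ℝ w v
      by_cases hu : y = u
      · subst hu; simp [h1]
      by_cases hv : y = v
      · subst hv; simp [h2]
      simp [hu, hv]
    rw [this]
    refine .union ?_ ((isCompact_segment' u w).union (isCompact_segment' w v))
    refine K.isCompact.of_isClosed_subset (isClosed_of_closure_subset ?_) Set.sdiff_subset
    intro x hx
    have hxK : x ∈ K.carrier :=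
      closure_minimal Set.sdiff_subset K.isCompact.isClosed hx
    refine ⟨hxK, fun hxo => ?_⟩
    have hxu : x ≠ u := by
      rintro rfl
      exact h.ne (left_mem_openSegment_iff.1 hxo)
    have hxv : x ≠ v := by
      rintro rfl
      exact h.ne (right_mem_openSegment_iff.1 hxo)
    refine (mem_closure_iff_frequently.1 hx) ?_
    -- Near an inner point of `[u, v]`, both `K` and the segment are the same line, so no point of
    -- `K` off the open segment is nearby.
    filter_upwards [h.straight x (openSegment_subset_segment _ _ _ hxo),
      eventually_mem_segment_of_mem_openSegment h.ne hxo,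
      isOpen_ne.mem_nhds hxu, isOpen_ne.mem_nhds hxv] with y h1 h2 h3 h4 h5
    exact h5.2 (mem_openSegment_of_ne_left_right (Ne.symm h3) (Ne.symm h4) (h2.2 (h1.1 h5.1)))
  locally_two_rays := by
    rintro x (⟨hx, hx'⟩ | hx | hx)
    · obtain ⟨d₁, d₂, hd, hK⟩ := K.locally_two_rays x hx
      have hns : x ∉ segment ℝ u w ∪ segment ℝ w v := by
        rintro (hs | hs)
        · exact hx' (h.side_inter_carrier hs hx ▸ left_mem_segment ℝ u v)
        · rw [segment_symm] at hs
          exact hx' (h.symm.side_inter_carrier hs hx ▸ right_mem_segment ℝ u v)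
      refine ⟨d₁, d₂, hd, ?_⟩
      filter_upwards [hK, eventually_iff_of_notMem hx' hns] with y h1 h2
      rw [h2, h1]
    · exact h.two_rays_of_mem_side hx
    · rw [replaceSide_symm]
      exact h.symm.two_rays_of_mem_side (segment_symm ℝ w v ▸ hx)

end IsReplaceable
end Link

theorem affineIndependent_of_linearIndependent {u v w : Space}
    (h : LinearIndependent ℝ ![v - u, w - u]) : AffineIndependent ℝ ![u, v, w] := by
  rw [affineIndependent_iff_not_collinear_set, collinear_iff_of_mem (p₀ := u) (by simp)]
  rintro ⟨d, hd⟩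
  obtain ⟨r, hr⟩ := hd v (by simp)
  obtain ⟨s, hs⟩ := hd w (by simp)
  have hv : v - u = r • d := by rw [hr]; simp
  have hw : w - u = s • d := by rw [hs]; simp
  have := LinearIndependent.pair_iff.1 h s (-r) (by rw [hv, hw]; module)
  refine h.ne_zero 1 ?_
  simp [hw, this.1]

namespace Link.IsReplaceable

variable {K : Link} {u v w : Space}

theorem triangleMove (h : K.IsReplaceable u v w) : TriangleMove K h.newLink :=
  ⟨u, v, w, affineIndependent_of_linearIndependent h.indep, h.hull_inter, rfl⟩

end Link.IsReplaceable

/-! ### Coordinates adapted to a crossing. -/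

/-- Affine coordinates of 3-space whose third axis is vertical. -/
structure Frame where
  origin : Space
  e : Space
  d : Space
  k : Space
  indep : LinearIndependent ℝ ![proj e, proj d]
  proj_k : proj k = 0
  k_pos : 0 < k 2

namespace Frame

variable (F : Frame)

/-- The point with the given coordinates. -/
def pt (a b h : ℝ) : Space := F.origin + (a • F.e + b • F.d + h • F.k)

theorem proj_pt (a b h : ℝ) :
    proj (F.pt a b h) = proj F.origin + (a • proj F.e + b • proj F.d) := by
  simp [pt, proj_add, proj_smul, F.proj_k]

theorem proj_pt_eq_iff {a b h a' b' h' : ℝ} :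
    proj (F.pt a b h) = proj (F.pt a' b' h') ↔ a = a' ∧ b = b' := by
  rw [proj_pt, proj_pt]
  constructor
  · exact fun h => F.indep.pair_unique (add_left_cancel h)
  · rintro ⟨rfl, rfl⟩; rfl

theorem pt_height_lt_iff {a b h h' : ℝ} : F.pt a b h 2 < F.pt a b h' 2 ↔ h < h' := by
  simp [pt, F.k_pos]

theorem pt_eq_iff {a b h a' b' h' : ℝ} :
    F.pt a b h = F.pt a' b' h' ↔ a = a' ∧ b = b' ∧ h = h' := by
  constructor
  · intro he
    obtain ⟨rfl, rfl⟩ := F.proj_pt_eq_iff.1 (congrArg proj he)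
    refine ⟨rfl, rfl, ?_⟩
    rcases lt_trichotomy h h' with hl | hl | hl
    · exact absurd (congrArg (fun x : Space => x 2) he) (F.pt_height_lt_iff.2 hl).ne
    · exact hl
    · exact absurd (congrArg (fun x : Space => x 2) he) (F.pt_height_lt_iff.2 hl).ne'
  · rintro ⟨rfl, rfl, rfl⟩; rfl

theorem linearIndependent : LinearIndependent ℝ ![F.e, F.d, F.k] := by
  rw [Fintype.linearIndependent_iff]
  intro g hg
  have : F.pt (g 0) (g 1) (g 2) = F.pt 0 0 0 := by
    rw [Fin.sum_univ_three] at hg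
    simpa [pt] using hg
  obtain ⟨h0, h1, h2⟩ := F.pt_eq_iff.1 this
  intro i; fin_cases i
  exacts [h0, h1, h2]

/-- The basis of the frame. -/
noncomputable def basis : Module.Basis (Fin 3) ℝ Space :=
  basisOfLinearIndependentOfCardEqFinrank F.linearIndependent (by simp)

/-- The coordinates of a point. -/
noncomputable def coord (i : Fin 3) (x : Space) : ℝ := F.basis.coord i (x - F.origin)

theorem continuous_coord (i : Fin 3) : Continuous (F.coord i) :=
  (LinearMap.continuous_of_finiteDimensional (F.basis.coord i)).comp
    (continuous_id.sub continuous_const)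

theorem pt_coord (x : Space) : F.pt (F.coord 0 x) (F.coord 1 x) (F.coord 2 x) = x := by
  have := F.basis.sum_repr (x - F.origin)
  rw [Fin.sum_univ_three] at this
  simp only [pt, coord, Module.Basis.coord_apply]
  rw [show F.basis 0 = F.e by simp [basis], show F.basis 1 = F.d by simp [basis],
    show F.basis 2 = F.k by simp [basis]] at this
  exact eq_sub_iff_add_eq'.1 this

theorem coord_pt (a b h : ℝ) : F.coord 0 (F.pt a b h) = a ∧ F.coord 1 (F.pt a b h) = b ∧
    F.coord 2 (F.pt a b h) = h :=
  F.pt_eq_iff.1 (F.pt_coord (F.pt a b h))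

theorem exists_eq_pt_of_proj_eq {x : Space} {a b h : ℝ} (hx : proj x = proj (F.pt a b h)) :
    ∃ h', x = F.pt a b h' := by
  rw [← F.pt_coord x] at hx
  obtain ⟨rfl, rfl⟩ := F.proj_pt_eq_iff.1 hx
  exact ⟨_, (F.pt_coord x).symm⟩

/-- Near a point of given coordinates, the coordinates are close to the given ones. -/
theorem eventually_exists_eq_pt {a b h ε : ℝ} (hε : 0 < ε) :
    ∀ᶠ y in 𝓝 (F.pt a b h), ∃ a' b' h', y = F.pt a' b' h' ∧ |a' - a| < ε ∧ |b' - b| < ε := by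
  obtain ⟨h0, h1, -⟩ := F.coord_pt a b h
  have H0 := (F.continuous_coord 0).tendsto (F.pt a b h)
  have H1 := (F.continuous_coord 1).tendsto (F.pt a b h)
  rw [h0] at H0
  rw [h1] at H1
  filter_upwards [H0 (Metric.ball_mem_nhds a hε), H1 (Metric.ball_mem_nhds b hε)] with y hy hy'
  exact ⟨_, _, _, (F.pt_coord y).symm, hy, hy'⟩

end Frame

/-- A frame at a crossing of a link, in which the lower strand is the first axis, and the upper
strand is parallel to the second axis. -/
structure CrossingBox (K : Link) extends Frame where
  mem_iff : ∀ a b h : ℝ, |a| ≤ 4 → |b| ≤ 4 →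
    (toFrame.pt a b h ∈ K.carrier ↔ (b = 0 ∧ h = 0) ∨ (a = 0 ∧ h = 1))

/-- Compactness: the part of the link outside the interior of `s` has closed projection, and this
misses `proj u` because only `o` and `u` lie above that point. It confines a whole vertical column,
at all heights, to the neighborhoods of `o` and `u`. -/
theorem Diagram.Over.eventually_mem {D : Diagram} {o u : Space} (h : D.Over o u) {s : Set Space}
    (ho : s ∈ 𝓝 o) (hu : s ∈ 𝓝 u) :
    ∀ᶠ P in 𝓝 (proj u), ∀ x ∈ D.toLink.carrier, proj x = P → x ∈ s := by
  obtain ⟨hoK, huK, hp, hlt⟩ := h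
  have hc : IsCompact (D.toLink.carrier \ interior s) := D.toLink.isCompact.diff isOpen_interior
  have hcl := (hc.image continuous_proj).isClosed
  have : proj u ∉ proj '' (D.toLink.carrier \ interior s) := by
    rintro ⟨x, ⟨hx, hxs⟩, hxp⟩
    rcases D.double x hx u huK o hoK hxp hp.symm with rfl | h | rfl
    · exact hxs (mem_interior_iff_mem_nhds.2 hu)
    · rw [h] at hlt; exact lt_irrefl _ hlt
    · exact hxs (mem_interior_iff_mem_nhds.2 ho)
  filter_upwards [hcl.isOpen_compl.mem_nhds this] with P hP x hx hxP
  by_contra hxs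
  exact hP ⟨x, ⟨hx, fun h => hxs (interior_subset h)⟩, hxP⟩

/-- The direction in `CrossingArcs` is unrelated to the one given by `transverse`; this compares
them. -/
theorem Link.StraightAt.exists_smul_eq {K : Link} {x d d' : Space} (h : K.StraightAt x d)
    (h' : ∀ᶠ t in 𝓝[>] (0 : ℝ), x + t • d' ∈ K.carrier) : ∃ r : ℝ, d' = r • d := by
  have hc : Tendsto (fun t : ℝ => x + t • d') (𝓝[>] 0) (𝓝 x) := by
    have : Continuous fun t : ℝ => x + t • d' := by fun_prop
    exact (this.tendsto' 0 x (by simp)).mono_left nhdsWithin_le_nhds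
  obtain ⟨t, ⟨ht1, ht2⟩, ht0⟩ := ((hc.eventually h).and h' |>.and self_mem_nhdsWithin).exists
  obtain ⟨s, hs⟩ := ht1.1 ht2
  have ht0 : t ≠ 0 := (Set.mem_Ioi.1 ht0).ne'
  refine ⟨t⁻¹ * s, ?_⟩
  rw [mul_smul, ← add_left_cancel hs, smul_smul, inv_mul_cancel₀ ht0, one_smul]

/-- Take the strand directions, shrunk by a small `ρ`, as horizontal axes and `o - u` as the
vertical one. The positive multiple of `e` records which under-arc lies on the positive first axis.
-/
theorem Diagram.Over.exists_crossingBox {D : Diagram} {o u : Space} (h : D.Over o u) {e : Space}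
    (he0 : e ≠ 0) (he : ∀ᶠ t in 𝓝[>] (0 : ℝ), u + t • e ∈ D.toLink.carrier) :
    ∃ F : CrossingBox D.toLink, F.origin = u ∧ F.k = o - u ∧ ∃ r : ℝ, 0 < r ∧ F.e = r • e := by
  obtain ⟨hoK, huK, hp, hlt⟩ := id h
  have hne : o ≠ u := by rintro rfl; exact lt_irrefl _ hlt
  obtain ⟨d, e', hd, he', hind⟩ := D.transverse o hoK u huK hne hp
  obtain ⟨r, rfl⟩ := he'.exists_smul_eq he
  have hr : r ≠ 0 := by rintro rfl; simp at he0
  have hind' : ∀ {ρ : ℝ}, ρ ≠ 0 → LinearIndependent ℝ ![proj (ρ • r • e'), proj (ρ • d)] := by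
    intro ρ hρ
    rw [LinearIndependent.pair_iff] at hind ⊢
    intro s t hst
    simp only [proj_smul, smul_smul] at hst
    have := hind (t * ρ) (s * (ρ * r)) (by rw [← hst, add_comm])
    simpa [hρ, hr] using this.symm
  obtain ⟨δ₁, hδ₁, hKo⟩ := Metric.eventually_nhds_iff.1 hd
  obtain ⟨δ₂, hδ₂, hKu⟩ := Metric.eventually_nhds_iff.1 he'
  obtain ⟨δ₃, hδ₃, hkey⟩ := Metric.eventually_nhds_iff.1 (h.eventually_mem
    (s := {y | (y ∈ D.toLink.carrier ↔ ∃ t : ℝ, y = o + t • d) ∨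
      (y ∈ D.toLink.carrier ↔ ∃ t : ℝ, y = u + t • e')})
    (hd.mono fun _ => Or.inl) (he'.mono fun _ => Or.inr))
  set C : ℝ := ‖d‖ + ‖r • e'‖ + ‖proj d‖ + ‖proj (r • e')‖ with hC
  have hC0 : 0 ≤ C := by positivity
  -- The 4 is the half-width of the box and the 1 keeps the denominator positive; `C` dominates the
  -- norms both in space and in the plane.
  set ρ : ℝ := min δ₁ (min δ₂ δ₃) / (1 + 4 * C) with hρ
  have hm : 0 < min δ₁ (min δ₂ δ₃) := lt_min hδ₁ (lt_min hδ₂ hδ₃)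
  have hρ0 : 0 < ρ := by positivity
  have hρC : 4 * ρ * C < min δ₁ (min δ₂ δ₃) := by
    have : ρ * (1 + 4 * C) = min δ₁ (min δ₂ δ₃) := by rw [hρ]; field_simp
    nlinarith
  have hρ1 : 4 * ρ * C < δ₁ := hρC.trans_le (min_le_left _ _)
  have hρ2 : 4 * ρ * C < δ₂ := hρC.trans_le ((min_le_right _ _).trans (min_le_left _ _))
  have hρ3 : 4 * ρ * C < δ₃ := hρC.trans_le ((min_le_right _ _).trans (min_le_right _ _))
  have bound : ∀ {E : Type} [NormedAddCommGroup E] [NormedSpace ℝ E] (a : ℝ) (x : E), |a| ≤ 4 →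
      ‖a • ρ • x‖ ≤ 4 * ρ * ‖x‖ := by
    intro E _ _ a x ha
    rw [norm_smul, norm_smul, Real.norm_eq_abs, Real.norm_of_nonneg hρ0.le, mul_assoc]
    gcongr
  let F : Frame :=
    { origin := u, e := ρ • r • e', d := ρ • d, k := o - u, indep := hind' hρ0.ne'
      proj_k := by rw [proj_sub, hp, sub_self]
      k_pos := by simpa using hlt }
  refine ⟨{ toFrame := F, mem_iff := ?_ }, rfl, rfl, ρ, hρ0, rfl⟩
  have n1 := norm_nonneg d
  have n2 := norm_nonneg (r • e')
  have n3 := norm_nonneg (proj d)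
  have n4 := norm_nonneg (proj (r • e'))
  intro a b c ha hb
  constructor
  · intro hX
    have hball : dist (proj (F.pt a b c)) (proj u) < δ₃ := by
      rw [F.proj_pt, dist_eq_norm]
      change ‖proj u + (a • proj (ρ • r • e') + b • proj (ρ • d)) - proj u‖ < δ₃
      rw [add_sub_cancel_left, proj_smul ρ d, proj_smul ρ]
      calc _ ≤ _ := norm_add_le _ _
        _ ≤ _ := add_le_add (bound a _ ha) (bound b _ hb)
        _ ≤ 4 * ρ * C := by
          rw [hC]; nlinarith [mul_nonneg hρ0.le n1, mul_nonneg hρ0.le n2]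
        _ < δ₃ := hρ3
    rcases hkey hball _ hX rfl with hl | hl
    · obtain ⟨t, ht⟩ := hl.1 hX
      obtain ⟨s, rfl⟩ : ∃ s, t = s * ρ := ⟨t / ρ, by field_simp⟩
      have : F.pt a b c = F.pt 0 s 1 := by
        rw [ht]
        change _ = u + ((0 : ℝ) • (ρ • r • e') + s • (ρ • d) + (1 : ℝ) • (o - u))
        module
      obtain ⟨h1, -, h2⟩ := F.pt_eq_iff.1 this
      exact Or.inr ⟨h1, h2⟩
    · obtain ⟨t, ht⟩ := hl.1 hX
      obtain ⟨s, rfl⟩ : ∃ s, t = s * (ρ * r) := ⟨t / (ρ * r), by field_simp⟩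
      have : F.pt a b c = F.pt s 0 0 := by
        rw [ht]
        change _ = u + (s • (ρ • r • e') + (0 : ℝ) • (ρ • d) + (0 : ℝ) • (o - u))
        module
      obtain ⟨-, h1, h2⟩ := F.pt_eq_iff.1 this
      exact Or.inl ⟨h1, h2⟩
  · rintro (⟨rfl, rfl⟩ | ⟨rfl, rfl⟩)
    · have hX : F.pt a 0 0 = u + a • ρ • r • e' := by
        change u + (a • (ρ • r • e') + (0 : ℝ) • (ρ • d) + (0 : ℝ) • (o - u)) = _
        module
      rw [hX]
      refine (hKu ?_).2 ⟨a * ρ * r, by module⟩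
      rw [dist_eq_norm, add_sub_cancel_left]
      refine (bound a _ ha).trans_lt (lt_of_le_of_lt ?_ hρ2)
      gcongr; linarith
    · have hX : F.pt 0 b 1 = o + b • ρ • d := by
        change u + ((0 : ℝ) • (ρ • r • e') + b • (ρ • d) + (1 : ℝ) • (o - u)) = _
        module
      rw [hX]
      refine (hKo ?_).2 ⟨b * ρ, by module⟩
      rw [dist_eq_norm, add_sub_cancel_left]
      refine (bound b _ hb).trans_lt (lt_of_le_of_lt ?_ hρ1)
      gcongr; linarith

namespace Frame

variable (F : Frame)

theorem pt_sub_pt (a b c a' b' c' : ℝ) :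
    F.pt a b c - F.pt a' b' c' = (a - a') • F.e + (b - b') • F.d + (c - c') • F.k := by
  simp only [pt]; module

theorem pt_add_smul_pt_sub (a b c a' b' c' t : ℝ) :
    F.pt a b c + t • (F.pt a' b' c' - F.pt a b c) =
      F.pt (a + t * (a' - a)) (b + t * (b' - b)) (c + t * (c' - c)) := by
  simp only [pt]; module

theorem mem_segment_iff {a b c a' b' c' : ℝ} {x : Space} :
    x ∈ segment ℝ (F.pt a b c) (F.pt a' b' c') ↔ ∃ t : ℝ, 0 ≤ t ∧ t ≤ 1 ∧
      x = F.pt (a + t * (a' - a)) (b + t * (b' - b)) (c + t * (c' - c)) := by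
  simp only [mem_segment_iff_exists, pt_add_smul_pt_sub]

theorem pt_add_smul_e (a b c t : ℝ) : F.pt a b c + t • F.e = F.pt (a + t) b c := by
  simp only [pt]; module

theorem pt_add_smul_d (a b c t : ℝ) : F.pt a b c + t • F.d = F.pt a (b + t) c := by
  simp only [pt]; module

theorem linearIndependent_proj {x y : Space} {a b a' b' c c' : ℝ}
    (hx : x = a • F.e + b • F.d + c • F.k) (hy : y = a' • F.e + b' • F.d + c' • F.k)
    (h : a * b' - a' * b ≠ 0) : LinearIndependent ℝ ![proj x, proj y] := by
  rw [LinearIndependent.pair_iff]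
  intro s t hst
  have := LinearIndependent.pair_iff.1 F.indep (s * a + t * a') (s * b + t * b') (by
    rw [← hst, hx, hy]
    simp only [proj_add, proj_smul, F.proj_k]
    module)
  constructor
  · have : s * (a * b' - a' * b) = 0 := by linear_combination b' * this.1 - a' * this.2
    exact (mul_eq_zero.1 this).resolve_right h
  · have : t * (a * b' - a' * b) = 0 := by linear_combination a * this.2 - b * this.1
    exact (mul_eq_zero.1 this).resolve_right h

end Frame

theorem LinearIndependent.of_proj {x y : Space} (h : LinearIndependent ℝ ![proj x, proj y]) :
    LinearIndependent ℝ ![x, y] := by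
  rw [LinearIndependent.pair_iff] at h ⊢
  intro s t hst
  refine h s t ?_
  rw [← proj_smul, ← proj_smul, ← proj_add, hst]
  simpa using proj_smul 0 0

/-! ### The detour in coordinates. -/

namespace CrossingBox

section Link

variable {K : Link} (F : CrossingBox K)

theorem lower_mem {a : ℝ} (ha : |a| ≤ 4) : F.pt a 0 0 ∈ K.carrier :=
  (F.mem_iff a 0 0 ha (by simp)).2 (Or.inl ⟨rfl, rfl⟩)

theorem upper_mem {b : ℝ} (hb : |b| ≤ 4) : F.pt 0 b 1 ∈ K.carrier :=
  (F.mem_iff 0 b 1 (by simp) hb).2 (Or.inr ⟨rfl, rfl⟩)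

/-- Within the box only the upper strand could interfere; it has height 1, which nearby points
avoid. -/
theorem straightAt_lower {a : ℝ} (ha : |a| < 4) : K.StraightAt (F.pt a 0 0) F.e := by
  have hε : 0 < min 1 (4 - |a|) := lt_min one_pos (by linarith)
  filter_upwards [F.eventually_exists_eq_pt (a := a) (b := 0) (h := 0) hε,
    (F.continuous_coord 2).continuousAt.eventually_ne (x := F.pt a 0 0) (y := 1)
      (by rw [(F.coord_pt _ _ _).2.2]; norm_num)] with y ⟨a', b', c', hy, ha', hb'⟩ hc'
  subst hy
  rw [(F.coord_pt _ _ _).2.2] at hc'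
  obtain ⟨h1, h2⟩ := lt_min_iff.1 ha'
  obtain ⟨h3, h4⟩ := lt_min_iff.1 hb'
  have h5 : |a'| ≤ 4 := by
    have := abs_sub_abs_le_abs_sub a' a
    linarith
  rw [sub_zero] at h3
  rw [F.mem_iff _ _ _ h5 (by linarith)]
  simp only [F.pt_add_smul_e, F.pt_eq_iff]
  constructor
  · rintro (⟨rfl, rfl⟩ | ⟨rfl, rfl⟩)
    · exact ⟨a' - a, by ring, rfl, rfl⟩
    · exact absurd rfl hc'
  · rintro ⟨t, rfl, rfl, rfl⟩; simp

theorem straightAt_upper {b : ℝ} (hb : |b| < 4) : K.StraightAt (F.pt 0 b 1) F.d := by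
  have hε : 0 < min 1 (4 - |b|) := lt_min one_pos (by linarith)
  filter_upwards [F.eventually_exists_eq_pt (a := 0) (b := b) (h := 1) hε,
    (F.continuous_coord 2).continuousAt.eventually_ne (x := F.pt 0 b 1) (y := 0)
      (by rw [(F.coord_pt _ _ _).2.2]; norm_num)] with y ⟨a', b', c', hy, ha', hb'⟩ hc'
  subst hy
  rw [(F.coord_pt _ _ _).2.2] at hc'
  obtain ⟨h1, h2⟩ := lt_min_iff.1 ha'
  obtain ⟨h3, h4⟩ := lt_min_iff.1 hb'
  have h5 : |b'| ≤ 4 := by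
    have := abs_sub_abs_le_abs_sub b' b
    linarith
  rw [sub_zero] at h1
  rw [F.mem_iff _ _ _ (by linarith) h5]
  simp only [F.pt_add_smul_d, F.pt_eq_iff]
  constructor
  · rintro (⟨rfl, rfl⟩ | ⟨rfl, rfl⟩)
    · exact absurd rfl hc'
    · exact ⟨b' - b, rfl, by ring, rfl⟩
  · rintro ⟨t, rfl, rfl, rfl⟩; simp

/-- The part of the lower strand that is to be replaced. -/
def base : Set Space := segment ℝ (F.pt 1 0 0) (F.pt 3 0 0)

/-- The two segments that replace the base: a detour over the upper strand. -/
def sides : Set Space :=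
  segment ℝ (F.pt 1 0 0) (F.pt (-1) 1 4) ∪ segment ℝ (F.pt (-1) 1 4) (F.pt 3 0 0)

theorem mem_base_iff {x : Space} : x ∈ F.base ↔ ∃ a, 1 ≤ a ∧ a ≤ 3 ∧ x = F.pt a 0 0 := by
  rw [base, F.mem_segment_iff]
  constructor
  · rintro ⟨t, h0, h1, rfl⟩
    exact ⟨1 + 2 * t, by linarith, by linarith, F.pt_eq_iff.2 ⟨by ring, by ring, by ring⟩⟩
  · rintro ⟨a, h0, h1, rfl⟩
    exact ⟨(a - 1) / 2, by linarith, by linarith, F.pt_eq_iff.2 ⟨by ring, by ring, by ring⟩⟩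

theorem mem_sides_iff {x : Space} : x ∈ F.sides ↔ ∃ t, 0 ≤ t ∧ t ≤ 1 ∧
    (x = F.pt (1 - 2 * t) t (4 * t) ∨ x = F.pt (3 - 4 * t) t (4 * t)) := by
  rw [sides, Set.mem_union, segment_symm ℝ (F.pt (-1) 1 4), F.mem_segment_iff, F.mem_segment_iff]
  constructor
  · rintro (⟨t, h0, h1, rfl⟩ | ⟨t, h0, h1, rfl⟩)
    · exact ⟨t, h0, h1, Or.inl (F.pt_eq_iff.2 ⟨by ring, by ring, by ring⟩)⟩
    · exact ⟨t, h0, h1, Or.inr (F.pt_eq_iff.2 ⟨by ring, by ring, by ring⟩)⟩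
  · rintro ⟨t, h0, h1, rfl | rfl⟩
    · exact Or.inl ⟨t, h0, h1, F.pt_eq_iff.2 ⟨by ring, by ring, by ring⟩⟩
    · exact Or.inr ⟨t, h0, h1, F.pt_eq_iff.2 ⟨by ring, by ring, by ring⟩⟩

theorem base_subset : F.base ⊆ K.carrier := by
  intro x hx
  obtain ⟨a, h0, h1, rfl⟩ := F.mem_base_iff.1 hx
  exact F.lower_mem (abs_le.2 ⟨by linarith, by linarith⟩)

/-- The triangle stays in the box, so only the two strands can meet it. It is steep enough that at
height 1 it has not yet reached the plane of the upper strand. -/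
theorem isReplaceable : K.IsReplaceable (F.pt 1 0 0) (F.pt 3 0 0) (F.pt (-1) 1 4) where
  indep := LinearIndependent.of_proj
    (F.linearIndependent_proj (F.pt_sub_pt _ _ _ _ _ _) (F.pt_sub_pt _ _ _ _ _ _) (by norm_num))
  hull_inter := by
    apply Set.Subset.antisymm
    · rintro x ⟨hx, hK⟩
      rw [show ({F.pt 1 0 0, F.pt 3 0 0, F.pt (-1) 1 4} : Set Space) =
        {F.pt (-1) 1 4, F.pt 1 0 0, F.pt 3 0 0} by
          ext; simp only [Set.mem_insert_iff, Set.mem_singleton_iff]; tauto,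
        convexHull_insert (by simp), convexHull_pair, mem_convexJoin] at hx
      obtain ⟨w, rfl, y, hy, hx⟩ := hx
      obtain ⟨a, ha1, ha3, rfl⟩ := F.mem_base_iff.1 hy
      obtain ⟨t, ht0, ht1, rfl⟩ := F.mem_segment_iff.1 hx
      rw [F.mem_iff _ _ _ (abs_le.2 ⟨by nlinarith, by nlinarith⟩)
        (abs_le.2 ⟨by nlinarith, by nlinarith⟩)] at hK
      rcases hK with ⟨h1, -⟩ | ⟨h1, h2⟩
      · refine F.mem_base_iff.2 ⟨a, ha1, ha3, F.pt_eq_iff.2 ?_⟩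
        obtain rfl : t = 1 := by linarith
        exact ⟨by ring, by ring, by ring⟩
      -- Height 1 forces this `t`, and a vanishing first coordinate would then require `a = 1 / 3`,
      -- outside the base.
      · obtain rfl : t = 3 / 4 := by linarith
        linarith
    · intro x hx
      refine ⟨(convex_convexHull ℝ _).segment_subset ?_ ?_ hx, F.base_subset hx⟩ <;>
        exact subset_convexHull _ _ (by simp)
  straight x hx := by
    obtain ⟨a, h0, h1, rfl⟩ := F.mem_base_iff.1 hx
    filter_upwards [F.straightAt_lower (abs_lt.2 ⟨by linarith, by linarith⟩)] with y hy
    rw [hy, F.pt_sub_pt]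
    exact ⟨fun ⟨t, ht⟩ => ⟨t / 2, by rw [ht]; module⟩, fun ⟨t, ht⟩ => ⟨2 * t, by rw [ht]; module⟩⟩

theorem carrier_newLink : F.isReplaceable.newLink.carrier = (K.carrier \ F.base) ∪ F.sides := rfl

/-- On both sides the height is four times the second coordinate, hence determined by the
projection. -/
theorem eq_of_proj_eq_of_mem_sides {x y : Space} (hx : x ∈ F.sides) (hy : y ∈ F.sides)
    (h : proj x = proj y) : x = y := by
  obtain ⟨s, hs0, hs1, rfl | rfl⟩ := F.mem_sides_iff.1 hx <;>
  obtain ⟨t, ht0, ht1, rfl | rfl⟩ := F.mem_sides_iff.1 hy <;>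
  obtain ⟨h1, h2⟩ := F.proj_pt_eq_iff.1 h <;>
  exact F.pt_eq_iff.2 ⟨by linarith, by linarith, by linarith⟩

/-- The base has first coordinate at least 1, away from the upper strand, so deleting it destroys no
crossing. -/
theorem eq_of_proj_eq_of_mem_base {x y : Space} (hx : x ∈ F.base) (hy : y ∈ K.carrier)
    (h : proj y = proj x) : y = x := by
  obtain ⟨a, h1, h3, rfl⟩ := F.mem_base_iff.1 hx
  obtain ⟨c, rfl⟩ := F.exists_eq_pt_of_proj_eq h
  rw [F.mem_iff _ _ _ (abs_le.2 ⟨by linarith, by linarith⟩) (by simp)] at hy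
  rcases hy with ⟨-, rfl⟩ | ⟨rfl, -⟩
  · rfl
  · norm_num at h1

/-- The first coordinates `1 - 2 * t` and `3 - 4 * t` vanish at `t = 1 / 2` and `t = 3 / 4`, at
heights 2 and 3, above the upper strand. The lower strand is met only at endpoints of the base. -/
theorem mem_or_of_proj_eq_of_mem_sides {x y : Space} (hx : x ∈ F.sides)
    (hy : y ∈ K.carrier \ F.base) (h : proj y = proj x) :
    (x = F.pt 0 (1 / 2) 2 ∧ y = F.pt 0 (1 / 2) 1) ∨
      (x = F.pt 0 (3 / 4) 3 ∧ y = F.pt 0 (3 / 4) 1) := by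
  obtain ⟨hy, hyb⟩ := hy
  obtain ⟨t, ht0, ht1, rfl | rfl⟩ := F.mem_sides_iff.1 hx <;>
  obtain ⟨c, rfl⟩ := F.exists_eq_pt_of_proj_eq h <;>
  rw [F.mem_iff _ _ _ (abs_le.2 ⟨by linarith, by linarith⟩)
    (abs_le.2 ⟨by linarith, by linarith⟩)] at hy <;>
  rcases hy with ⟨rfl, rfl⟩ | ⟨h1, rfl⟩
  · exact absurd (F.mem_base_iff.2 ⟨1, le_rfl, by norm_num, by simp⟩) hyb
  · obtain rfl : t = 1 / 2 := by linarith
    left; norm_num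
  · exact absurd (F.mem_base_iff.2 ⟨3, by norm_num, le_rfl, by simp⟩) hyb
  · obtain rfl : t = 3 / 4 := by linarith
    right; norm_num

theorem notMem_sides {x : Space} (hx : x ∈ K.carrier \ F.base) : x ∉ F.sides := by
  intro h
  rcases F.mem_or_of_proj_eq_of_mem_sides h hx rfl with ⟨h1, h2⟩ | ⟨h1, h2⟩ <;>
  · have := (F.pt_eq_iff.1 (h1.symm.trans h2)).2.2
    norm_num at this

theorem isClosed_sides : IsClosed F.sides :=
  (isClosed_segment' _ _).union (isClosed_segment' _ _)

theorem eventually_mem_newLink_iff {x : Space} (hx : x ∈ K.carrier \ F.base) :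
    ∀ᶠ y in 𝓝 x, y ∈ F.isReplaceable.newLink.carrier ↔ y ∈ K.carrier :=
  Link.IsReplaceable.eventually_iff_of_notMem hx.2 (F.notMem_sides hx)

theorem straightAt_newLink {x d : Space} (hx : x ∈ K.carrier \ F.base) (h : K.StraightAt x d) :
    F.isReplaceable.newLink.StraightAt x d := by
  filter_upwards [F.eventually_mem_newLink_iff hx, h] with y h1 h2
  rw [h1, h2]

theorem upper_mem_sdiff {b : ℝ} (hb : |b| ≤ 4) : F.pt 0 b 1 ∈ K.carrier \ F.base := by
  refine ⟨F.upper_mem hb, fun h => ?_⟩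
  obtain ⟨a, h1, h3, h⟩ := F.mem_base_iff.1 h
  linarith [(F.pt_eq_iff.1 h).1]

theorem straightAt_left :
    F.isReplaceable.newLink.StraightAt (F.pt 0 (1 / 2) 2) (F.pt (-1) 1 4 - F.pt 1 0 0) :=
  F.isReplaceable.eventually_of_mem_openSegment <| mem_openSegment_iff_exists.2
    ⟨1 / 2, by norm_num, by norm_num, by rw [F.pt_add_smul_pt_sub]; norm_num⟩

theorem straightAt_right :
    F.isReplaceable.newLink.StraightAt (F.pt 0 (3 / 4) 3) (F.pt (-1) 1 4 - F.pt 3 0 0) := by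
  have := F.isReplaceable.symm.eventually_of_mem_openSegment (x := F.pt 0 (3 / 4) 3)
    (mem_openSegment_iff_exists.2
    ⟨3 / 4, by norm_num, by norm_num, by rw [F.pt_add_smul_pt_sub]; norm_num⟩)
  rwa [Link.replaceSide_symm] at this

end Link

/-! ### The new diagram and its crossings. -/

variable {D : Diagram} (F : CrossingBox D.toLink)

/-- The crossings of the new link: those of the old one, and two new ones. -/
theorem pair_cases {x y : Space} (hx : x ∈ F.isReplaceable.newLink.carrier)
    (hy : y ∈ F.isReplaceable.newLink.carrier) (hne : x ≠ y) (h : proj x = proj y) :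
    (x ∈ D.toLink.carrier \ F.base ∧ y ∈ D.toLink.carrier \ F.base) ∨
    (x = F.pt 0 (1 / 2) 2 ∧ y = F.pt 0 (1 / 2) 1) ∨ (x = F.pt 0 (3 / 4) 3 ∧ y = F.pt 0 (3 / 4) 1) ∨
    (y = F.pt 0 (1 / 2) 2 ∧ x = F.pt 0 (1 / 2) 1) ∨
      (y = F.pt 0 (3 / 4) 3 ∧ x = F.pt 0 (3 / 4) 1) := by
  rw [F.carrier_newLink] at hx hy
  rcases hx with hx | hx <;> rcases hy with hy | hy
  · exact Or.inl ⟨hx, hy⟩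
  · rcases F.mem_or_of_proj_eq_of_mem_sides hy hx h with h | h <;> simp [h]
  · rcases F.mem_or_of_proj_eq_of_mem_sides hx hy h.symm with h | h <;> simp [h]
  · exact absurd (F.eq_of_proj_eq_of_mem_sides hx hy h) hne

/-- The diagram in which a piece of the lower strand has been moved over the upper strand. -/
def newDiagram : Diagram where
  toLink := F.isReplaceable.newLink
  finite_multiple := by
    refine (D.finite_multiple.union (Set.toFinite {F.pt 0 (1 / 2) 2, F.pt 0 (1 / 2) 1,
      F.pt 0 (3 / 4) 3, F.pt 0 (3 / 4) 1})).subset ?_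
    rintro x ⟨hx, y, hy, hne, h⟩
    rcases F.pair_cases hy hx hne h with ⟨h1, h2⟩ | h | h | h | h
    · exact Or.inl ⟨h2.1, y, h1.1, hne, h⟩
    all_goals right; simp [h]
  double := by
    intro x hx y hy z hz hxy hyz
    by_contra! hc
    obtain ⟨h1, h2, h3⟩ := hc
    have hn1 : ∀ {b : ℝ}, |b| ≤ 4 → F.pt 0 b 1 ∉ F.sides := fun hb =>
      F.notMem_sides (F.upper_mem_sdiff hb)
    -- A detour point has at most one old partner, since the heights 2 and 3 tell the two new
    -- crossings apart; this excludes triple points.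
    have key : ∀ {x y z : Space}, x ∈ F.sides → y ∈ D.toLink.carrier \ F.base →
        z ∈ D.toLink.carrier \ F.base → proj x = proj y → proj y = proj z → y = z := by
      intro x y z hx hy hz hxy hyz
      rcases F.mem_or_of_proj_eq_of_mem_sides hx hy hxy.symm with ⟨h1, h2⟩ | ⟨h1, h2⟩ <;>
      rcases F.mem_or_of_proj_eq_of_mem_sides hx hz (hxy.trans hyz).symm with ⟨h3, h4⟩ | ⟨h3, h4⟩
      · rw [h2, h4]
      · have := (F.pt_eq_iff.1 (h1.symm.trans h3)).2.2
        norm_num at this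
      · have := (F.pt_eq_iff.1 (h1.symm.trans h3)).2.2
        norm_num at this
      · rw [h2, h4]
    rw [F.carrier_newLink] at hx hy hz
    rcases hx with hx | hx <;> rcases hy with hy | hy <;> rcases hz with hz | hz
    · rcases D.double x hx.1 y hy.1 z hz.1 hxy hyz with h | h | h
      exacts [h1 h, h2 h, h3 h]
    · exact h1 (key hz hx hy (hxy.trans hyz).symm hxy)
    · exact h3 (key hy hx hz hxy.symm (hxy.trans hyz))
    · exact h2 (F.eq_of_proj_eq_of_mem_sides hy hz hyz)
    · exact h2 (key hx hy hz hxy hyz)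
    · exact h3 (F.eq_of_proj_eq_of_mem_sides hx hz (hxy.trans hyz))
    · exact h1 (F.eq_of_proj_eq_of_mem_sides hx hy hxy)
    · exact h1 (F.eq_of_proj_eq_of_mem_sides hx hy hxy)
  transverse := by
    have hd : F.d = (0 : ℝ) • F.e + (1 : ℝ) • F.d + (0 : ℝ) • F.k := by module
    have hu : ∀ {b : ℝ}, |b| < 4 → F.isReplaceable.newLink.StraightAt (F.pt 0 b 1) F.d :=
      fun hb => F.straightAt_newLink (F.upper_mem_sdiff hb.le) (F.straightAt_upper hb)
    have h2 : |(1 / 2 : ℝ)| < 4 := by rw [abs_lt]; norm_num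
    have h3 : |(3 / 4 : ℝ)| < 4 := by rw [abs_lt]; norm_num
    intro x hx y hy hne h
    rcases F.pair_cases hx hy hne h with ⟨hx, hy⟩ | ⟨rfl, rfl⟩ | ⟨rfl, rfl⟩ | ⟨rfl, rfl⟩ | ⟨rfl, rfl⟩
    · obtain ⟨d, e, hd, he, hi⟩ := D.transverse x hx.1 y hy.1 hne h
      exact ⟨d, e, F.straightAt_newLink hx hd, F.straightAt_newLink hy he, hi⟩
    · exact ⟨_, _, F.straightAt_left, hu h2,
        F.linearIndependent_proj (F.pt_sub_pt _ _ _ _ _ _) hd (by norm_num)⟩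
    · exact ⟨_, _, F.straightAt_right, hu h3,
        F.linearIndependent_proj (F.pt_sub_pt _ _ _ _ _ _) hd (by norm_num)⟩
    · exact ⟨_, _, hu h2, F.straightAt_left,
        F.linearIndependent_proj hd (F.pt_sub_pt _ _ _ _ _ _) (by norm_num)⟩
    · exact ⟨_, _, hu h3, F.straightAt_right,
        F.linearIndependent_proj hd (F.pt_sub_pt _ _ _ _ _ _) (by norm_num)⟩

theorem over_newDiagram_iff {o u : Space} : F.newDiagram.Over o u ↔ D.Over o u ∨
    (o = F.pt 0 (1 / 2) 2 ∧ u = F.pt 0 (1 / 2) 1) ∨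
      (o = F.pt 0 (3 / 4) 3 ∧ u = F.pt 0 (3 / 4) 1) := by
  have h2 : |(1 / 2 : ℝ)| ≤ 4 := by rw [abs_le]; norm_num
  have h3 : |(3 / 4 : ℝ)| ≤ 4 := by rw [abs_le]; norm_num
  constructor
  · rintro ⟨ho, hu, hp, hlt⟩
    have hne : o ≠ u := by rintro rfl; exact lt_irrefl _ hlt
    rcases F.pair_cases ho hu hne hp with ⟨hx, hy⟩ | h | h | ⟨rfl, rfl⟩ | ⟨rfl, rfl⟩
    · exact Or.inl ⟨hx.1, hy.1, hp, hlt⟩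
    · exact Or.inr (Or.inl h)
    · exact Or.inr (Or.inr h)
    · rw [F.pt_height_lt_iff] at hlt; norm_num at hlt
    · rw [F.pt_height_lt_iff] at hlt; norm_num at hlt
  · rintro (⟨ho, hu, hp, hlt⟩ | ⟨rfl, rfl⟩ | ⟨rfl, rfl⟩)
    · have hne : o ≠ u := by rintro rfl; exact lt_irrefl _ hlt
      refine ⟨Or.inl ⟨ho, fun h => ?_⟩, Or.inl ⟨hu, fun h => ?_⟩, hp, hlt⟩
      · exact hne (F.eq_of_proj_eq_of_mem_base h hu hp.symm).symm
      · exact hne (F.eq_of_proj_eq_of_mem_base h ho hp)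
    · exact ⟨Or.inr (F.mem_sides_iff.2 ⟨1 / 2, by norm_num, by norm_num, by left; norm_num⟩),
        Or.inl (F.upper_mem_sdiff h2), F.proj_pt_eq_iff.2 ⟨rfl, rfl⟩,
        F.pt_height_lt_iff.2 (by norm_num)⟩
    · exact ⟨Or.inr (F.mem_sides_iff.2 ⟨3 / 4, by norm_num, by norm_num, by right; norm_num⟩),
        Or.inl (F.upper_mem_sdiff h3), F.proj_pt_eq_iff.2 ⟨rfl, rfl⟩,
        F.pt_height_lt_iff.2 (by norm_num)⟩

end CrossingBox

/-! ### Arcs, and colorings as locally constant functions. -/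

namespace Diagram

variable {D : Diagram}

theorem finite_under (D : Diagram) : {x | ∃ o, D.Over o x}.Finite :=
  D.finite_multiple.subset fun x ⟨o, ho, hx, hp, hlt⟩ =>
    ⟨hx, o, ho, by rintro rfl; exact lt_irrefl _ hlt, hp⟩

/-- A point above `o` would make a triple point. -/
theorem Over.mem_strands {o u : Space} (h : D.Over o u) : o ∈ D.strands := by
  obtain ⟨ho, hu, hp, hlt⟩ := h
  refine ⟨ho, ?_⟩
  rintro ⟨o', ho', -, hp', hlt'⟩
  rcases D.double o' ho' o ho u hu hp' hp with rfl | rfl | rfl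
  · exact lt_irrefl _ hlt'
  · exact lt_irrefl _ hlt
  · exact lt_asymm hlt hlt'

theorem OnArc.of_isPreconnected {S : Set Space} (hS : IsPreconnected S) (hsub : S ⊆ D.strands)
    {x y : Space} (hx : x ∈ S) (hy : y ∈ S) {A : D.Arc} (h : D.OnArc x A) : D.OnArc y A := by
  obtain ⟨hxs, rfl⟩ := h
  refine ⟨hsub hy, ConnectedComponents.coe_eq_coe'.2 ?_⟩
  have hT : IsPreconnected ((↑) ⁻¹' S : Set D.strands) := by
    rw [← Topology.IsInducing.subtypeVal.isPreconnected_image, Subtype.image_preimage_coe,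
      Set.inter_eq_right.2 hsub]
    exact hS
  exact hT.subset_connectedComponent (show (⟨x, hxs⟩ : D.strands) ∈ _ from hx) hy

theorem exists_onArc {x : Space} (h : x ∈ D.strands) : ∃ A, D.OnArc x A := ⟨_, h, rfl⟩

/-- A point of a strand is joined to the nearby points of the strands by segments. -/
theorem eventually_segment_subset {x : Space} (hx : x ∈ D.strands) :
    ∀ᶠ y in 𝓝 x, y ∈ D.strands → segment ℝ x y ⊆ D.strands := by
  obtain ⟨d₁, d₂, -, hK⟩ := D.toLink.locally_two_rays x hx.1
  obtain ⟨r, hr, hball⟩ := Metric.eventually_nhds_iff_ball.1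
    (hK.and (D.finite_under.isClosed.isOpen_compl.mem_nhds hx.2))
  filter_upwards [Metric.ball_mem_nhds x hr] with y hy hys z hz
  obtain ⟨h1, h2⟩ := hball z
    ((convex_ball x r).segment_subset (Metric.mem_ball_self hr) hy hz)
  obtain ⟨s, hs, -, rfl⟩ := mem_segment_iff_exists.1 hz
  obtain ⟨t, ht, hyt⟩ := (hball y hy).1.1 hys.1
  refine ⟨h1.2 ⟨s * t, mul_nonneg hs ht, ?_⟩, h2⟩
  rcases hyt with rfl | rfl
  · left; module
  · right; module

/-- A short open interval leaving `u` is connected, so it stays on one arc. Thus crossings can be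
treated without naming arcs. -/
theorem eventually_onArc_of_eventually_mem {u d : Space}
    (h : ∀ᶠ t in 𝓝[>] (0 : ℝ), u + t • d ∈ D.strands) :
    ∃ A, ∀ᶠ t in 𝓝[>] (0 : ℝ), D.OnArc (u + t • d) A := by
  obtain ⟨ε, hε, hsub⟩ := mem_nhdsGT_iff_exists_Ioo_subset.1 h
  have hε : 0 < ε := hε
  have hS : IsPreconnected ((fun t : ℝ => u + t • d) '' Set.Ioo 0 ε) :=
    isPreconnected_Ioo.image _ (by fun_prop)
  have hsub' : (fun t : ℝ => u + t • d) '' Set.Ioo 0 ε ⊆ D.strands := Set.image_subset_iff.2 hsub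
  have hmem : ε / 2 ∈ Set.Ioo 0 ε := ⟨by linarith, by linarith⟩
  obtain ⟨A, hA⟩ := exists_onArc (hsub hmem)
  refine ⟨A, ?_⟩
  filter_upwards [Ioo_mem_nhdsGT hε] with t ht
  exact hA.of_isPreconnected hS hsub' (Set.mem_image_of_mem _ hmem) (Set.mem_image_of_mem _ ht)

namespace Coloring

variable {p : ℕ}

open Classical in
/-- The color of a point of the diagram. -/
noncomputable def colorAt (c : D.Coloring p) (x : Space) : ZMod p :=
  if h : x ∈ D.strands then c.color (ConnectedComponents.mk (⟨x, h⟩ : D.strands)) else 0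

variable (c : D.Coloring p)

theorem colorAt_of_onArc {x : Space} {A : D.Arc} (h : D.OnArc x A) : c.colorAt x = c.color A := by
  obtain ⟨hx, rfl⟩ := h
  exact dif_pos hx

theorem range_color : Set.range c.color = c.colorAt '' D.strands := by
  ext k
  constructor
  · rintro ⟨A, rfl⟩
    obtain ⟨⟨x, hx⟩, rfl⟩ := ConnectedComponents.surjective_coe A
    exact ⟨x, hx, c.colorAt_of_onArc ⟨hx, rfl⟩⟩
  · rintro ⟨x, hx, rfl⟩
    exact ⟨_, (c.colorAt_of_onArc ⟨hx, rfl⟩).symm⟩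

theorem colorAt_eq_of_isPreconnected {S : Set Space} (hS : IsPreconnected S)
    (hsub : S ⊆ D.strands) {x y : Space} (hx : x ∈ S) (hy : y ∈ S) :
    c.colorAt x = c.colorAt y := by
  obtain ⟨A, hA⟩ := exists_onArc (hsub hx)
  rw [c.colorAt_of_onArc hA, c.colorAt_of_onArc (hA.of_isPreconnected hS hsub hx hy)]

theorem eventually_colorAt_eq {x : Space} (hx : x ∈ D.strands) :
    ∀ᶠ y in 𝓝 x, y ∈ D.strands → c.colorAt y = c.colorAt x := by
  filter_upwards [eventually_segment_subset hx] with y hy hys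
  exact c.colorAt_eq_of_isPreconnected (convex_segment x y).isPreconnected (hy hys)
    (right_mem_segment ℝ x y) (left_mem_segment ℝ x y)

theorem eventually_condition {o u d : Space} (h : D.Over o u)
    (hd : ∀ᶠ t in 𝓝[>] (0 : ℝ), u - t • d ∈ D.strands ∧ u + t • d ∈ D.strands) :
    ∀ᶠ t in 𝓝[>] (0 : ℝ), 2 * c.colorAt o = c.colorAt (u - t • d) + c.colorAt (u + t • d) := by
  obtain ⟨B, hB⟩ := exists_onArc h.mem_strands
  obtain ⟨A, hA⟩ := eventually_onArc_of_eventually_mem (u := u) (d := -d)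
    (hd.mono fun t ht => by simpa [sub_eq_add_neg] using ht.1)
  obtain ⟨C, hC⟩ := eventually_onArc_of_eventually_mem (hd.mono fun t ht => ht.2)
  have hA' : ∀ᶠ t in 𝓝[>] (0 : ℝ), D.OnArc (u - t • d) A := by
    simpa [sub_eq_add_neg] using hA
  have hcond := c.condition A B C ⟨o, u, h, hB, d, hA'.and hC⟩
  filter_upwards [hA', hC] with t h1 h2
  rw [c.colorAt_of_onArc hB, c.colorAt_of_onArc h1, c.colorAt_of_onArc h2, hcond]

/-- The coloring given by a locally constant function on the strands. -/
noncomputable def ofFun (f : Space → ZMod p)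
    (hf : ∀ x ∈ D.strands, ∀ᶠ y in 𝓝 x, y ∈ D.strands → f y = f x)
    (hc : ∀ o u d : Space, D.Over o u →
      (∀ᶠ t in 𝓝[>] (0 : ℝ), u - t • d ∈ D.strands ∧ u + t • d ∈ D.strands) →
      ∀ᶠ t in 𝓝[>] (0 : ℝ), 2 * f o = f (u - t • d) + f (u + t • d)) : D.Coloring p where
  color := Quotient.lift (fun x : D.strands => f x) fun x y h => by
    have hl : IsLocallyConstant fun x : D.strands => f x := by
      rw [IsLocallyConstant.iff_eventually_eq]
      rintro ⟨x, hx⟩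
      have := (continuous_subtype_val.tendsto (⟨x, hx⟩ : D.strands)).eventually (hf x hx)
      exact this.mono fun y hy => hy y.2
    have hxy : connectedComponent x = connectedComponent y := h
    exact hl.apply_eq_of_isPreconnected isPreconnected_connectedComponent
      mem_connectedComponent (hxy ▸ mem_connectedComponent)
  condition := by
    rintro A B C ⟨o, u, ho, ⟨hoB, rfl⟩, d, hd⟩
    have := hc o u d ho (hd.mono fun t ht => ⟨ht.1.1, ht.2.1⟩)
    obtain ⟨t, ht, ⟨h1, rfl⟩, ⟨h2, rfl⟩⟩ := (this.and hd).exists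
    exact ht

theorem colorAt_ofFun {f : Space → ZMod p} {hf hc} {x : Space} (hx : x ∈ D.strands) :
    (ofFun (D := D) f hf hc).colorAt x = f x :=
  colorAt_of_onArc _ ⟨hx, rfl⟩

theorem HasCrossing.of_colorAt {o u d : Space} (h : D.Over o u)
    (hd : ∀ᶠ t in 𝓝[>] (0 : ℝ), u - t • d ∈ D.strands ∧ u + t • d ∈ D.strands) {x y z : ZMod p}
    (hy : c.colorAt o = y) (hxz : ∀ᶠ t in 𝓝[>] (0 : ℝ),
      c.colorAt (u - t • d) = x ∧ c.colorAt (u + t • d) = z) : c.HasCrossing x y z := by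
  obtain ⟨B, hB⟩ := exists_onArc h.mem_strands
  obtain ⟨A, hA⟩ := eventually_onArc_of_eventually_mem (u := u) (d := -d)
    (hd.mono fun t ht => by simpa [sub_eq_add_neg] using ht.1)
  obtain ⟨C, hC⟩ := eventually_onArc_of_eventually_mem (hd.mono fun t ht => ht.2)
  have hA' : ∀ᶠ t in 𝓝[>] (0 : ℝ), D.OnArc (u - t • d) A := by
    simpa [sub_eq_add_neg] using hA
  obtain ⟨t, h1, h2, h3, h4⟩ := (hA'.and (hC.and hxz)).exists
  refine ⟨A, B, C, ⟨o, u, h, hB, d, hA'.and hC⟩, ?_, ?_, ?_⟩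
  · rw [← c.colorAt_of_onArc h1, h3]
  · rw [← c.colorAt_of_onArc hB, hy]
  · rw [← c.colorAt_of_onArc h2, h4]

end Coloring

end Diagram

theorem tendsto_add_smul {E : Type*} [NormedAddCommGroup E] [NormedSpace ℝ E] (u d : E) :
    Tendsto (fun t : ℝ => u + t • d) (𝓝[>] 0) (𝓝 u) := by
  have : Continuous fun t : ℝ => u + t • d := by fun_prop
  exact (this.tendsto' 0 u (by simp)).mono_left nhdsWithin_le_nhds

/-! ### The coloring of the new diagram. -/

namespace CrossingBox

variable {D : Diagram} (F : CrossingBox D.toLink) {p : ℕ} (c : D.Coloring p)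

theorem eq_of_proj_eq_upper {b : ℝ} (hb : |b| ≤ 4) (hb0 : b ≠ 0) {x : Space}
    (hx : x ∈ D.toLink.carrier) (h : proj x = proj (F.pt 0 b 1)) : x = F.pt 0 b 1 := by
  obtain ⟨c, rfl⟩ := F.exists_eq_pt_of_proj_eq h
  rcases (F.mem_iff _ _ _ (by simp) hb).1 hx with ⟨h1, -⟩ | ⟨-, rfl⟩
  · exact absurd h1 hb0
  · rfl

theorem upper_mem_strands {b : ℝ} (hb : |b| ≤ 4) : F.pt 0 b 1 ∈ D.strands := by
  refine ⟨F.upper_mem hb, ?_⟩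
  rintro ⟨o, ho, -, hp, hlt⟩
  obtain ⟨c, rfl⟩ := F.exists_eq_pt_of_proj_eq hp
  rw [F.pt_height_lt_iff] at hlt
  rcases (F.mem_iff _ _ _ (by simp) hb).1 ho with ⟨-, rfl⟩ | ⟨-, rfl⟩
  · norm_num at hlt
  · exact lt_irrefl _ hlt

theorem lower_mem_strands {a : ℝ} (ha : |a| ≤ 4) (ha0 : a ≠ 0) : F.pt a 0 0 ∈ D.strands := by
  refine ⟨F.lower_mem ha, ?_⟩
  rintro ⟨o, ho, -, hp, hlt⟩
  obtain ⟨c, rfl⟩ := F.exists_eq_pt_of_proj_eq hp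
  rw [F.pt_height_lt_iff] at hlt
  rcases (F.mem_iff _ _ _ ha (by simp)).1 ho with ⟨-, rfl⟩ | ⟨h0, -⟩
  · exact lt_irrefl _ hlt
  · exact ha0 h0

theorem colorAt_upper {b : ℝ} (hb : |b| ≤ 4) :
    c.colorAt (F.pt 0 b 1) = c.colorAt (F.pt 0 0 1) := by
  refine c.colorAt_eq_of_isPreconnected (S := segment ℝ (F.pt 0 b 1) (F.pt 0 0 1))
    (convex_segment _ _).isPreconnected ?_ (left_mem_segment _ _ _) (right_mem_segment _ _ _)
  intro x hx
  obtain ⟨t, h0, h1, rfl⟩ := F.mem_segment_iff.1 hx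
  rw [show (0 : ℝ) + t * (0 - 0) = 0 by ring, show (1 : ℝ) + t * (1 - 1) = 1 by ring]
  refine F.upper_mem_strands ?_
  rw [abs_le] at hb ⊢
  constructor <;> nlinarith

theorem colorAt_lower {a : ℝ} (ha0 : 0 < a) (ha : a ≤ 4) :
    c.colorAt (F.pt a 0 0) = c.colorAt (F.pt 1 0 0) := by
  refine c.colorAt_eq_of_isPreconnected (S := segment ℝ (F.pt a 0 0) (F.pt 1 0 0))
    (convex_segment _ _).isPreconnected ?_ (left_mem_segment _ _ _) (right_mem_segment _ _ _)
  intro x hx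
  obtain ⟨t, h0, h1, rfl⟩ := F.mem_segment_iff.1 hx
  rw [show (0 : ℝ) + t * (0 - 0) = 0 by ring]
  have h2 : 0 < a + t * (1 - a) := by
    rcases h1.eq_or_lt with rfl | h1
    · linarith
    · nlinarith
  exact F.lower_mem_strands (abs_le.2 ⟨by linarith, by nlinarith⟩) h2.ne'

/-- The piece of the upper strand that passes under the detour. -/
def middle : Set Space := openSegment ℝ (F.pt 0 (1 / 2) 1) (F.pt 0 (3 / 4) 1)

theorem mem_middle_iff {x : Space} :
    x ∈ F.middle ↔ ∃ b, 1 / 2 < b ∧ b < 3 / 4 ∧ x = F.pt 0 b 1 := by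
  simp only [middle, mem_openSegment_iff_exists, F.pt_add_smul_pt_sub]
  constructor
  · rintro ⟨t, h0, h1, rfl⟩
    exact ⟨1 / 2 + t / 4, by linarith, by linarith, F.pt_eq_iff.2 ⟨by ring, by ring, by ring⟩⟩
  · rintro ⟨b, h0, h1, rfl⟩
    exact ⟨4 * b - 2, by linarith, by linarith, F.pt_eq_iff.2 ⟨by ring, by ring, by ring⟩⟩

/-- The middle piece together with its endpoints. -/
def closedMiddle : Set Space := segment ℝ (F.pt 0 (1 / 2) 1) (F.pt 0 (3 / 4) 1)

theorem mem_closedMiddle_iff {x : Space} :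
    x ∈ F.closedMiddle ↔ ∃ b, 1 / 2 ≤ b ∧ b ≤ 3 / 4 ∧ x = F.pt 0 b 1 := by
  simp only [closedMiddle, mem_segment_iff_exists, F.pt_add_smul_pt_sub]
  constructor
  · rintro ⟨t, h0, h1, rfl⟩
    exact ⟨1 / 2 + t / 4, by linarith, by linarith, F.pt_eq_iff.2 ⟨by ring, by ring, by ring⟩⟩
  · rintro ⟨b, h0, h1, rfl⟩
    exact ⟨4 * b - 2, by linarith, by linarith, F.pt_eq_iff.2 ⟨by ring, by ring, by ring⟩⟩

theorem middle_subset : F.middle ⊆ F.closedMiddle := openSegment_subset_segment _ _ _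

theorem eventually_notMem_closedMiddle {x : Space} (hx : x ∉ F.closedMiddle) :
    ∀ᶠ y in 𝓝 x, y ∉ F.closedMiddle :=
  (isClosed_segment' _ _).isOpen_compl.mem_nhds hx

theorem eventually_notMem_sides {x : Space} (hx : x ∉ F.sides) : ∀ᶠ y in 𝓝 x, y ∉ F.sides :=
  F.isClosed_sides.isOpen_compl.mem_nhds hx

/-- Nothing passes above the detour, and the upper strand loses exactly the two points where the
detour crosses it. -/
theorem mem_strands_newDiagram_iff {x : Space} : x ∈ F.newDiagram.strands ↔ x ∈ F.sides ∨
    (x ∈ D.strands ∧ x ∉ F.base ∧ x ≠ F.pt 0 (1 / 2) 1 ∧ x ≠ F.pt 0 (3 / 4) 1) := by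
  have hu : ∀ {b : ℝ}, 0 < b → b ≤ 1 → F.pt 0 b 1 ∉ F.sides := fun h0 h1 =>
    F.notMem_sides (F.upper_mem_sdiff (abs_le.2 ⟨by linarith, by linarith⟩))
  constructor
  · rintro ⟨hx | hx, hn⟩
    · refine Or.inr ⟨⟨hx.1, fun ⟨o, ho⟩ => hn ⟨o, ?_⟩⟩, hx.2, ?_, ?_⟩
      · exact F.over_newDiagram_iff.2 (Or.inl ho)
      · exact fun h => hn ⟨_, F.over_newDiagram_iff.2 (Or.inr (Or.inl ⟨rfl, h⟩))⟩
      · exact fun h => hn ⟨_, F.over_newDiagram_iff.2 (Or.inr (Or.inr ⟨rfl, h⟩))⟩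
    · exact Or.inl hx
  · rintro (hx | ⟨hx, h1, h2, h3⟩)
    · refine ⟨Or.inr hx, ?_⟩
      rintro ⟨o, ho⟩
      rcases F.over_newDiagram_iff.1 ho with ⟨ho, hxK, hp, hlt⟩ | ⟨-, rfl⟩ | ⟨-, rfl⟩
      · by_cases hb : x ∈ F.base
        · rw [F.eq_of_proj_eq_of_mem_base hb ho hp] at hlt
          exact lt_irrefl _ hlt
        · exact F.notMem_sides ⟨hxK, hb⟩ hx
      · exact hu (by norm_num) (by norm_num) hx
      · exact hu (by norm_num) (by norm_num) hx
    · refine ⟨Or.inl ⟨hx.1, h1⟩, ?_⟩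
      rintro ⟨o, ho⟩
      rcases F.over_newDiagram_iff.1 ho with ho | ⟨-, h⟩ | ⟨-, h⟩
      exacts [hx.2 ⟨o, ho⟩, h2 h, h3 h]

open Classical in
/-- The colors of the points of the new diagram. -/
noncomputable def newColor (x : Space) : ZMod p :=
  if x ∈ F.sides then c.colorAt (F.pt 1 0 0)
  else if x ∈ F.middle then 2 * c.colorAt (F.pt 1 0 0) - c.colorAt (F.pt 0 0 1)
  else c.colorAt x

theorem newColor_of_mem_sides {x : Space} (h : x ∈ F.sides) :
    F.newColor c x = c.colorAt (F.pt 1 0 0) := if_pos h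

theorem newColor_of_mem_middle {x : Space} (h : x ∈ F.middle) :
    F.newColor c x = 2 * c.colorAt (F.pt 1 0 0) - c.colorAt (F.pt 0 0 1) := by
  have : x ∉ F.sides := by
    obtain ⟨b, h0, h1, rfl⟩ := F.mem_middle_iff.1 h
    exact F.notMem_sides (F.upper_mem_sdiff (abs_le.2 ⟨by linarith, by linarith⟩))
  rw [newColor, if_neg this, if_pos h]

theorem newColor_of_notMem {x : Space} (h : x ∉ F.sides) (h' : x ∉ F.middle) :
    F.newColor c x = c.colorAt x := by
  rw [newColor, if_neg h, if_neg h']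

theorem newColor_upper {b : ℝ} (hb : |b| ≤ 4) (h : b ≤ 1 / 2 ∨ 3 / 4 ≤ b) :
    F.newColor c (F.pt 0 b 1) = c.colorAt (F.pt 0 0 1) := by
  rw [F.newColor_of_notMem c (F.notMem_sides (F.upper_mem_sdiff hb)), F.colorAt_upper c hb]
  intro hm
  obtain ⟨b', h0, h1, he⟩ := F.mem_middle_iff.1 hm
  have := (F.pt_eq_iff.1 he).2.1
  rcases h with h | h <;> linarith

/-- The definition by cases can only jump where its pieces meet. The detour joins the old lower
strand at points of the same color, and the ends of the middle piece are undercrossings, hence not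
on the strands. -/
theorem eventually_newColor_eq {x : Space} (hx : x ∈ F.newDiagram.strands) :
    ∀ᶠ y in 𝓝 x, y ∈ F.newDiagram.strands → F.newColor c y = F.newColor c x := by
  by_cases hs : x ∈ F.sides
  · rw [F.newColor_of_mem_sides c hs]
    by_cases hK : x ∈ D.toLink.carrier
    · have hb : x ∈ F.base := by
        by_contra hb
        exact F.notMem_sides ⟨hK, hb⟩ hs
      obtain ⟨a, h1, h3, rfl⟩ := F.mem_base_iff.1 hb
      have hm : F.pt a 0 0 ∉ F.closedMiddle := by
        intro hm
        obtain ⟨b, -, -, he⟩ := F.mem_closedMiddle_iff.1 hm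
        linarith [(F.pt_eq_iff.1 he).1]
      have hst : F.pt a 0 0 ∈ D.strands :=
        F.lower_mem_strands (abs_le.2 ⟨by linarith, by linarith⟩) (by linarith)
      filter_upwards [c.eventually_colorAt_eq hst, F.eventually_notMem_closedMiddle hm]
        with y h4 h5 hy
      by_cases hys : y ∈ F.sides
      · exact F.newColor_of_mem_sides c hys
      · rw [F.newColor_of_notMem c hys (fun h => h5 (F.middle_subset h)),
          h4 ((F.mem_strands_newDiagram_iff.1 hy).resolve_left hys).1,
          F.colorAt_lower c (by linarith) (by linarith)]
    · filter_upwards [D.toLink.isCompact.isClosed.isOpen_compl.mem_nhds hK] with y h1 hy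
      refine F.newColor_of_mem_sides c ((F.mem_strands_newDiagram_iff.1 hy).resolve_right ?_)
      exact fun h => h1 h.1.1
  · obtain ⟨hst, hb, h1, h2⟩ := (F.mem_strands_newDiagram_iff.1 hx).resolve_left hs
    by_cases hm : x ∈ F.middle
    · rw [F.newColor_of_mem_middle c hm]
      obtain ⟨b, hb1, hb2, rfl⟩ := F.mem_middle_iff.1 hm
      have hε : 0 < min (b - 1 / 2) (3 / 4 - b) := lt_min (by linarith) (by linarith)
      filter_upwards [F.eventually_notMem_sides hs, F.eventually_exists_eq_pt hε,
        F.straightAt_upper (abs_lt.2 ⟨by linarith, by linarith⟩)] with y h3 h4 h5 hy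
      obtain ⟨a', b', c', rfl, -, hb'⟩ := h4
      obtain ⟨t, ht⟩ := h5.1 ((F.mem_strands_newDiagram_iff.1 hy).resolve_left h3).1.1
      rw [F.pt_add_smul_d] at ht
      rw [ht]
      rw [(F.pt_eq_iff.1 ht).2.1, lt_min_iff, abs_lt, abs_lt] at hb'
      exact F.newColor_of_mem_middle c
        (F.mem_middle_iff.2 ⟨b + t, by linarith, by linarith, rfl⟩)
    · rw [F.newColor_of_notMem c hs hm]
      have hcm : x ∉ F.closedMiddle := fun h =>
        hm (mem_openSegment_of_ne_left_right h1.symm h2.symm h)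
      filter_upwards [F.eventually_notMem_sides hs, F.eventually_notMem_closedMiddle hcm,
        c.eventually_colorAt_eq hst] with y h3 h4 h5 hy
      rw [F.newColor_of_notMem c h3 (fun h => h4 (F.middle_subset h)),
        h5 ((F.mem_strands_newDiagram_iff.1 hy).resolve_left h3).1]

/-- Neither `o` nor `u` lies on the detour or on the closed middle piece, so near `u`, as at `o`,
the colors are the old ones. -/
theorem newColor_condition_of_over {o u d : Space} (h : D.Over o u)
    (hd : ∀ᶠ t in 𝓝[>] (0 : ℝ),
      u - t • d ∈ F.newDiagram.strands ∧ u + t • d ∈ F.newDiagram.strands) :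
    ∀ᶠ t in 𝓝[>] (0 : ℝ),
      2 * F.newColor c o = F.newColor c (u - t • d) + F.newColor c (u + t • d) := by
  obtain ⟨ho, hu, hp, hlt⟩ := id h
  have hne : o ≠ u := by rintro rfl; exact lt_irrefl _ hlt
  have hns : ∀ {x y}, x ∈ D.toLink.carrier → y ∈ D.toLink.carrier → proj x = proj y → x ≠ y →
      x ∉ F.sides ∧ x ∉ F.closedMiddle := by
    intro x y hx hy hxy hne
    refine ⟨F.notMem_sides ⟨hx, fun hb =>
      hne (F.eq_of_proj_eq_of_mem_base hb hy hxy.symm).symm⟩, fun hm => ?_⟩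
    obtain ⟨b, h0, h1, rfl⟩ := F.mem_closedMiddle_iff.1 hm
    exact hne (F.eq_of_proj_eq_upper (abs_le.2 ⟨by linarith, by linarith⟩) (by linarith)
      hy hxy.symm).symm
  obtain ⟨ho1, ho2⟩ := hns ho hu hp hne
  obtain ⟨hu1, hu2⟩ := hns hu ho hp.symm hne.symm
  have hnear := (F.eventually_notMem_sides hu1).and (F.eventually_notMem_closedMiddle hu2)
  have hd' : ∀ᶠ t in 𝓝[>] (0 : ℝ), (u - t • d ∈ D.strands ∧ u + t • d ∈ D.strands) ∧
      F.newColor c (u - t • d) = c.colorAt (u - t • d) ∧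
      F.newColor c (u + t • d) = c.colorAt (u + t • d) := by
    have hm := (tendsto_add_smul u (-d)).eventually hnear
    simp only [smul_neg, ← sub_eq_add_neg] at hm
    filter_upwards [hd, hm, (tendsto_add_smul u d).eventually hnear] with t h1 h2 h3
    exact ⟨⟨((F.mem_strands_newDiagram_iff.1 h1.1).resolve_left h2.1).1,
      ((F.mem_strands_newDiagram_iff.1 h1.2).resolve_left h3.1).1⟩,
      F.newColor_of_notMem c h2.1 (fun h => h2.2 (F.middle_subset h)),
      F.newColor_of_notMem c h3.1 (fun h => h3.2 (F.middle_subset h))⟩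
  filter_upwards [c.eventually_condition h (hd'.mono fun t ht => ht.1), hd'] with t h1 h2
  rw [F.newColor_of_notMem c ho1 (fun h => ho2 (F.middle_subset h)), h1, h2.2.1, h2.2.2]

/-- At each new crossing the over-color is that of the detour, and the under-colors are `c.colorAt
(F.pt 0 0 1)` and its reflection in that color. -/
theorem newColor_condition {o u d : Space} (h : F.newDiagram.Over o u)
    (hd : ∀ᶠ t in 𝓝[>] (0 : ℝ),
      u - t • d ∈ F.newDiagram.strands ∧ u + t • d ∈ F.newDiagram.strands) :
    ∀ᶠ t in 𝓝[>] (0 : ℝ),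
      2 * F.newColor c o = F.newColor c (u - t • d) + F.newColor c (u + t • d) := by
  -- Any admissible `d` runs along the upper strand; it is nonzero because `u` is itself not on a
  -- strand.
  have key : ∀ b : ℝ, 1 / 2 ≤ b → b ≤ 3 / 4 → u = F.pt 0 b 1 →
      ∃ r : ℝ, r ≠ 0 ∧ ∀ t : ℝ, u - t • d = F.pt 0 (b - t * r) 1 ∧
        u + t • d = F.pt 0 (b + t * r) 1 := by
    rintro b h0 h1 rfl
    have hb : |b| < 4 := abs_lt.2 ⟨by linarith, by linarith⟩
    obtain ⟨r, rfl⟩ := (F.straightAt_newLink (F.upper_mem_sdiff hb.le)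
      (F.straightAt_upper hb)).exists_smul_eq (hd.mono fun t ht => ht.2.1)
    refine ⟨r, ?_, fun t => ⟨?_, ?_⟩⟩
    · rintro rfl
      obtain ⟨t, -, ht⟩ := hd.exists
      rw [zero_smul, smul_zero, add_zero] at ht
      exact ht.2 ⟨o, h⟩
    · rw [sub_eq_add_neg, smul_smul, ← neg_smul, F.pt_add_smul_d, ← sub_eq_add_neg]
    · rw [smul_smul, F.pt_add_smul_d]
  -- The sign of `r` is free, so both orders of the under-arcs occur. The bound `1 / 8` is below the
  -- length `1 / 4` of the middle piece.
  have small : ∀ r : ℝ, r ≠ 0 → ∀ᶠ t in 𝓝[>] (0 : ℝ),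
      (0 < t * r ∧ t * r < 1 / 8) ∨ (t * r < 0 ∧ -(1 / 8) < t * r) := by
    intro r hr
    have ht : Tendsto (fun t : ℝ => t * r) (𝓝[>] 0) (𝓝 0) :=
      ((continuous_id.mul continuous_const).tendsto' 0 0 (by simp)).mono_left nhdsWithin_le_nhds
    filter_upwards [ht (Ioo_mem_nhds (show -(1 / 8 : ℝ) < 0 by norm_num)
      (show (0 : ℝ) < 1 / 8 by norm_num)), self_mem_nhdsWithin] with t h1 h2
    rcases hr.lt_or_gt with hr | hr
    · exact Or.inr ⟨mul_neg_of_pos_of_neg h2 hr, h1.1⟩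
    · exact Or.inl ⟨mul_pos h2 hr, h1.2⟩
  rcases F.over_newDiagram_iff.1 h with h | ⟨rfl, hu⟩ | ⟨rfl, hu⟩
  · exact F.newColor_condition_of_over c h hd
  · obtain ⟨r, hr, hru⟩ := key _ le_rfl (by norm_num) hu
    filter_upwards [small r hr] with t ht
    rw [(hru t).1, (hru t).2, F.newColor_of_mem_sides c
      (F.mem_sides_iff.2 ⟨1 / 2, by norm_num, by norm_num, by left; norm_num⟩)]
    rcases ht with ⟨h1, h2⟩ | ⟨h1, h2⟩
    · rw [F.newColor_upper c (abs_le.2 ⟨by linarith, by linarith⟩) (Or.inl (by linarith)),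
        F.newColor_of_mem_middle c (F.mem_middle_iff.2 ⟨_, by linarith, by linarith, rfl⟩)]
      ring
    · rw [F.newColor_upper c (b := 1 / 2 + t * r) (abs_le.2 ⟨by linarith, by linarith⟩)
          (Or.inl (by linarith)),
        F.newColor_of_mem_middle c (F.mem_middle_iff.2 ⟨_, by linarith, by linarith, rfl⟩)]
      ring
  · obtain ⟨r, hr, hru⟩ := key _ (by norm_num) le_rfl hu
    filter_upwards [small r hr] with t ht
    rw [(hru t).1, (hru t).2, F.newColor_of_mem_sides c
      (F.mem_sides_iff.2 ⟨3 / 4, by norm_num, by norm_num, by right; norm_num⟩)]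
    rcases ht with ⟨h1, h2⟩ | ⟨h1, h2⟩
    · rw [F.newColor_upper c (b := 3 / 4 + t * r) (abs_le.2 ⟨by linarith, by linarith⟩)
          (Or.inr (by linarith)),
        F.newColor_of_mem_middle c (F.mem_middle_iff.2 ⟨_, by linarith, by linarith, rfl⟩)]
      ring
    · rw [F.newColor_upper c (abs_le.2 ⟨by linarith, by linarith⟩) (Or.inr (by linarith)),
        F.newColor_of_mem_middle c (F.mem_middle_iff.2 ⟨_, by linarith, by linarith, rfl⟩)]
      ring

/-- The coloring of the new diagram. -/
noncomputable def newColoring : F.newDiagram.Coloring p :=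
  .ofFun (F.newColor c) (fun _ hx => F.eventually_newColor_eq c hx)
    (fun _ _ _ h hd => F.newColor_condition c h hd)

theorem upper_mem_strands_newDiagram {b : ℝ} (hb : |b| ≤ 4) (h2 : b ≠ 1 / 2) (h3 : b ≠ 3 / 4) :
    F.pt 0 b 1 ∈ F.newDiagram.strands :=
  F.mem_strands_newDiagram_iff.2 (Or.inr ⟨F.upper_mem_strands hb, (F.upper_mem_sdiff hb).2,
    fun h => h2 (F.pt_eq_iff.1 h).2.1, fun h => h3 (F.pt_eq_iff.1 h).2.1⟩)

/-- Colors of deleted or recolored points survive elsewhere: that of the base on the detour, that of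
the middle piece at `F.pt 0 0 1`. -/
theorem range_newColoring : Set.range (F.newColoring c).color =
    insert (2 * c.colorAt (F.pt 1 0 0) - c.colorAt (F.pt 0 0 1)) (Set.range c.color) := by
  have hnew : (F.newColoring c).colorAt '' F.newDiagram.strands =
      F.newColor c '' F.newDiagram.strands :=
    Set.image_congr fun x hx => Diagram.Coloring.colorAt_ofFun hx
  have h1 : F.pt 1 0 0 ∈ F.sides :=
    F.mem_sides_iff.2 ⟨0, le_rfl, zero_le_one, by left; norm_num⟩
  have h0 : F.pt 0 0 1 ∈ F.newDiagram.strands :=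
    F.upper_mem_strands_newDiagram (by simp) (by norm_num) (by norm_num)
  rw [Diagram.Coloring.range_color, Diagram.Coloring.range_color, hnew]
  apply Set.Subset.antisymm
  · rintro _ ⟨x, hx, rfl⟩
    by_cases hs : x ∈ F.sides
    · rw [F.newColor_of_mem_sides c hs]
      exact Or.inr ⟨_, F.lower_mem_strands (by simp) one_ne_zero, rfl⟩
    by_cases hm : x ∈ F.middle
    · exact Or.inl (F.newColor_of_mem_middle c hm)
    · rw [F.newColor_of_notMem c hs hm]
      exact Or.inr ⟨x, ((F.mem_strands_newDiagram_iff.1 hx).resolve_left hs).1, rfl⟩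
  · rintro _ (rfl | ⟨x, hx, rfl⟩)
    · have hb : |(5 / 8 : ℝ)| ≤ 4 := by rw [abs_le]; norm_num
      exact ⟨F.pt 0 (5 / 8) 1, F.upper_mem_strands_newDiagram hb (by norm_num) (by norm_num),
        F.newColor_of_mem_middle c
          (F.mem_middle_iff.2 ⟨5 / 8, by norm_num, by norm_num, rfl⟩)⟩
    · by_cases hb : x ∈ F.base
      · obtain ⟨a, ha1, ha3, rfl⟩ := F.mem_base_iff.1 hb
        refine ⟨F.pt 1 0 0, F.mem_strands_newDiagram_iff.2 (Or.inl h1), ?_⟩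
        rw [F.newColor_of_mem_sides c h1, F.colorAt_lower c (a := a) (by linarith) (by linarith)]
      by_cases hm : x ∈ F.closedMiddle
      · obtain ⟨b, hb1, hb3, rfl⟩ := F.mem_closedMiddle_iff.1 hm
        refine ⟨F.pt 0 0 1, h0, ?_⟩
        rw [F.newColor_upper c (by simp) (Or.inl (by norm_num)),
          F.colorAt_upper c (b := b) (abs_le.2 ⟨by linarith, by linarith⟩)]
      · refine ⟨x, F.mem_strands_newDiagram_iff.2 (Or.inr ⟨hx, hb, ?_, ?_⟩),
          F.newColor_of_notMem c (F.notMem_sides ⟨hx.1, hb⟩) (fun h => hm (F.middle_subset h))⟩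
        · rintro rfl; exact hm (left_mem_segment _ _ _)
        · rintro rfl; exact hm (right_mem_segment _ _ _)

/-- This is the crossing at second coordinate `1 / 2`, traversed along `F.d` so that the new color
comes last, ready for iteration. -/
theorem hasCrossing_newColoring : (F.newColoring c).HasCrossing (c.colorAt (F.pt 0 0 1))
    (c.colorAt (F.pt 1 0 0)) (2 * c.colorAt (F.pt 1 0 0) - c.colorAt (F.pt 0 0 1)) := by
  have ho : F.newDiagram.Over (F.pt 0 (1 / 2) 2) (F.pt 0 (1 / 2) 1) :=
    F.over_newDiagram_iff.2 (Or.inr (Or.inl ⟨rfl, rfl⟩))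
  have hs : F.pt 0 (1 / 2) 2 ∈ F.sides :=
    F.mem_sides_iff.2 ⟨1 / 2, by norm_num, by norm_num, by left; norm_num⟩
  have hsub : ∀ t : ℝ, F.pt 0 (1 / 2) 1 - t • F.d = F.pt 0 (1 / 2 - t) 1 := fun t => by
    rw [sub_eq_add_neg, ← neg_smul, F.pt_add_smul_d, ← sub_eq_add_neg]
  have hd : ∀ᶠ t in 𝓝[>] (0 : ℝ), F.pt 0 (1 / 2) 1 - t • F.d ∈ F.newDiagram.strands ∧
      F.pt 0 (1 / 2) 1 + t • F.d ∈ F.newDiagram.strands := by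
    filter_upwards [Ioo_mem_nhdsGT (show (0 : ℝ) < 1 / 8 by norm_num)] with t ⟨h0, h1⟩
    rw [hsub, F.pt_add_smul_d]
    exact ⟨F.upper_mem_strands_newDiagram (abs_le.2 ⟨by linarith, by linarith⟩)
      (by linarith) (by linarith), F.upper_mem_strands_newDiagram
      (abs_le.2 ⟨by linarith, by linarith⟩) (by linarith) (by linarith)⟩
  refine .of_colorAt _ ho hd ?_ ?_
  · rw [newColoring, Diagram.Coloring.colorAt_ofFun ho.mem_strands, F.newColor_of_mem_sides c hs]
  · filter_upwards [hd, Ioo_mem_nhdsGT (show (0 : ℝ) < 1 / 8 by norm_num)] with t ht ⟨h0, h1⟩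
    rw [newColoring, Diagram.Coloring.colorAt_ofFun ht.1, Diagram.Coloring.colorAt_ofFun ht.2, hsub,
      F.pt_add_smul_d]
    exact ⟨F.newColor_upper c (abs_le.2 ⟨by linarith, by linarith⟩) (Or.inl (by linarith)),
      F.newColor_of_mem_middle c (F.mem_middle_iff.2 ⟨_, by linarith, by linarith, rfl⟩)⟩

end CrossingBox

/-! ### Adding colors one at a time. -/

/-- A coloring with a crossing colored `x`, `y`, `z` gives one of a diagram of the same link, with
the additional color `2 * z - y`, and a crossing colored `y`, `z`, `2 * z - y`. -/
theorem Diagram.Coloring.HasCrossing.exists_coloring {D : Diagram} {p : ℕ} {c : D.Coloring p}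
    {x y z : ZMod p} (h : c.HasCrossing x y z) :
    ∃ (D' : Diagram) (c' : D'.Coloring p), D.toLink.TriangleMove D'.toLink ∧
      Set.range c'.color = insert (2 * z - y) (Set.range c.color) ∧
      c'.HasCrossing y z (2 * z - y) := by
  obtain ⟨A, B, C, ⟨o, u, ho, hoB, d, hd⟩, -, rfl, rfl⟩ := h
  have hd0 : d ≠ 0 := by
    rintro rfl
    obtain ⟨t, -, ht⟩ := hd.exists
    rw [smul_zero, add_zero] at ht
    exact ht.1.2 ⟨o, ho⟩
  obtain ⟨F, hFu, hFk, r, hr, hFe⟩ :=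
    ho.exists_crossingBox hd0 (hd.mono fun t ht => ht.2.1.1)
  have hy : c.colorAt (F.pt 0 0 1) = c.color B := by
    have : F.pt 0 0 1 = o := by simp [Frame.pt, hFu, hFk]
    rw [this, c.colorAt_of_onArc hoB]
  have hz : c.colorAt (F.pt 1 0 0) = c.color C := by
    obtain ⟨ε, hε, hsub⟩ := mem_nhdsGT_iff_exists_Ioo_subset.1 hd
    have hε : 0 < ε := hε
    -- A point of the positive first axis so near `u` that it is known to lie on `C`; the axis is
    -- then followed out to `F.pt 1 0 0`.
    have hm : 0 < min 1 (ε / (2 * r)) := lt_min one_pos (by positivity)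
    rw [← F.colorAt_lower c hm ((min_le_left _ _).trans (by norm_num))]
    have : F.pt (min 1 (ε / (2 * r))) 0 0 = u + (min 1 (ε / (2 * r)) * r) • d := by
      simp [Frame.pt, hFu, hFe, smul_smul]
    rw [this]
    refine c.colorAt_of_onArc (hsub ⟨by positivity, ?_⟩).2
    calc _ ≤ ε / (2 * r) * r := by gcongr; exact min_le_right _ _
      _ = ε / 2 := by field_simp
      _ < ε := by linarith
  refine ⟨F.newDiagram, F.newColoring c, F.isReplaceable.triangleMove, ?_, ?_⟩
  · rw [F.range_newColoring, hy, hz]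
  · rw [← hy, ← hz]
    exact F.hasCrossing_newColoring c

namespace Diagram.Coloring

variable {D : Diagram} {p : ℕ}

theorem isNontrivial_iff (c : D.Coloring p) : c.IsNontrivial ↔ (Set.range c.color).Nontrivial := by
  constructor
  · rintro ⟨A, B, h⟩
    exact ⟨_, ⟨A, rfl⟩, _, ⟨B, rfl⟩, h⟩
  · rintro ⟨_, ⟨A, rfl⟩, _, ⟨B, rfl⟩, h⟩
    exact ⟨A, B, h⟩

theorem numColors_le [NeZero p] (c : D.Coloring p) : c.numColors ≤ p := by
  have := Set.ncard_le_ncard (Set.subset_univ (Set.range c.color))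
  rwa [Set.ncard_univ, Nat.card_zmod] at this

/-- The coloring obtained by an affine change of the colors. -/
def affine (c : D.Coloring p) (r s : ZMod p) : D.Coloring p where
  color A := r * (c.color A - s)
  condition A B C h := by linear_combination r * c.condition A B C h

theorem range_affine (c : D.Coloring p) (r s : ZMod p) :
    Set.range (c.affine r s).color = (fun k => r * (k - s)) '' Set.range c.color := by
  rw [← Set.range_comp]; rfl

theorem HasCrossing.affine {c : D.Coloring p} {x y z : ZMod p} (h : c.HasCrossing x y z)
    (r s : ZMod p) : (c.affine r s).HasCrossing (r * (x - s)) (r * (y - s)) (r * (z - s)) := by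
  obtain ⟨A, B, C, h, rfl, rfl, rfl⟩ := h
  exact ⟨A, B, C, h, rfl, rfl, rfl⟩

theorem injective_affine {r : ZMod p} (hr : IsUnit r) (s : ZMod p) :
    Function.Injective fun k : ZMod p => r * (k - s) := fun _ _ h =>
  sub_left_injective (hr.mul_left_cancel h)

/-- All larger numbers of colors occur for the link of a diagram with a coloring in which the colors
up to `k + 2` occur, with a crossing colored `k`, `k + 1`, `k + 2`. -/
theorem exists_numColors_eq [NeZero p] {n : ℕ} (hn : n ≤ p) (m : ℕ) :
    ∀ (D : Diagram) (c : D.Coloring p) (k : ℕ), p ≤ k + 3 + m →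
      (∀ i ≤ k + 2, (i : ZMod p) ∈ Set.range c.color) →
      c.HasCrossing k ((k + 1 : ℕ) : ZMod p) ((k + 2 : ℕ) : ZMod p) → c.IsNontrivial →
      c.numColors ≤ n →
      ∃ (D' : Diagram) (c' : D'.Coloring p), D.toLink.Equivalent D'.toLink ∧ c'.IsNontrivial ∧
        c'.numColors = n := by
  induction m with
  | zero =>
    intro D c k hk hi _ hnt hle
    refine ⟨D, c, .refl _, hnt, hle.antisymm (hn.trans ?_)⟩
    -- Here `p ≤ k + 3`, so `0, …, k + 2` represent all residues and `p` colors are used.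
    have : Set.range c.color = Set.univ := by
      rw [Set.eq_univ_iff_forall]
      intro x
      rw [← ZMod.natCast_zmod_val x]
      exact hi _ (by have := x.val_lt; omega)
    rw [numColors, this, Set.ncard_univ, Nat.card_zmod]
  | succ m ih =>
    intro D c k hk hi hcr hnt hle
    rcases hle.eq_or_lt with heq | hlt
    · exact ⟨D, c, .refl _, hnt, heq⟩
    obtain ⟨D₁, c₁, hmove, hrange, hcr₁⟩ := hcr.exists_coloring
    -- The new color prolongs the arithmetic progression. It may already be in use, in which case
    -- the count does not change.
    have hk3 : 2 * ((k + 2 : ℕ) : ZMod p) - ((k + 1 : ℕ) : ZMod p) = ((k + 3 : ℕ) : ZMod p) := by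
      push_cast; ring
    rw [hk3] at hrange hcr₁
    obtain ⟨D', c', he, hc'⟩ := ih D₁ c₁ (k + 1) (by omega)
      (by
        intro i hik
        rw [hrange]
        rcases hik.eq_or_lt with rfl | h
        · exact Or.inl rfl
        · exact Or.inr (hi i (by omega)))
      hcr₁
      (by
        rw [isNontrivial_iff] at hnt ⊢
        exact hnt.mono (hrange ▸ Set.subset_insert _ _))
      (by
        rw [numColors, hrange]
        exact (Set.ncard_insert_le _ _).trans hlt)
    exact ⟨D', c', (Relation.EqvGen.rel _ _ hmove).trans _ _ _ he, hc'⟩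

end Diagram.Coloring

/-! ### The spectrum. -/

namespace Link

variable {L : Link} {p : ℕ}

theorem bddAbove_colorNumbers [NeZero p] (D : Diagram) : BddAbove (D.colorNumbers p) :=
  ⟨p, fun _ ⟨c, _, h⟩ => h ▸ c.numColors_le⟩

theorem sSup_colorNumbers_le [NeZero p] {D : Diagram} (h : (D.colorNumbers p).Nonempty) :
    sSup (D.colorNumbers p) ≤ p :=
  csSup_le h fun _ ⟨c, _, h⟩ => h ▸ c.numColors_le

theorem Spec_subset [NeZero p] : L.Spec p ⊆ Set.Icc (L.mincol p) (L.maxcol p) := by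
  rintro n ⟨D, hD, hn⟩
  constructor
  · have hmem : sInf (D.colorNumbers p) ∈ {m | ∃ D : Diagram, D.IsDiagramOf L ∧
        (D.colorNumbers p).Nonempty ∧ m = sInf (D.colorNumbers p)} := ⟨D, hD, ⟨n, hn⟩, rfl⟩
    exact (Nat.sInf_le hmem).trans (Nat.sInf_le hn)
  -- The bound `p` is needed because `sSup` of an unbounded set of naturals is 0.
  · have hb : BddAbove {m | ∃ D : Diagram, D.IsDiagramOf L ∧ (D.colorNumbers p).Nonempty ∧
        m = sSup (D.colorNumbers p)} := by
      refine ⟨p, ?_⟩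
      rintro m ⟨D', -, hne, rfl⟩
      exact sSup_colorNumbers_le hne
    exact (le_csSup (bddAbove_colorNumbers D) hn).trans (le_csSup hb ⟨D, hD, ⟨n, hn⟩, rfl⟩)

theorem maxcol_le [NeZero p] (h : L.HasNontrivialColoring p) : L.maxcol p ≤ p := by
  obtain ⟨D, hD, c, hc⟩ := h
  have hne : (D.colorNumbers p).Nonempty := ⟨_, c, hc, rfl⟩
  refine csSup_le ⟨_, D, hD, hne, rfl⟩ ?_
  rintro m ⟨D', -, hne, rfl⟩
  exact sSup_colorNumbers_le hne

theorem Spec_eq_of_hasCrossing [NeZero p] {D : Diagram} {c : D.Coloring p}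
    (hc : L.IsMinimalColoring c) (hcr : c.HasCrossing 0 1 2) :
    L.Spec p = Set.Icc (L.mincol p) (L.maxcol p) := by
  obtain ⟨hD, hnt, hmin⟩ := hc
  refine Spec_subset.antisymm fun n hn => ?_
  -- Start at `k = 0`; `m = p` is a generous number of steps.
  obtain ⟨D', c', he, hc', rfl⟩ := Diagram.Coloring.exists_numColors_eq
    (hn.2.trans (maxcol_le ⟨D, hD, c, hnt⟩)) p D c 0 (by omega)
    (by
      obtain ⟨A, B, C, -, hA, hB, hC⟩ := hcr
      intro i hi
      interval_cases i
      exacts [⟨A, by simpa using hA⟩, ⟨B, by simpa using hB⟩, ⟨C, by simpa using hC⟩])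
    (by simpa using hcr) hnt (hmin.trans_le hn.1)
  exact ⟨D', hD.trans _ _ _ he, c', hc', rfl⟩

/-- The bijection `k ↦ (b - a)⁻¹ * (k - a)` preserves colorings and their number of colors, and
normalizes the crossing to `0, 1, 2`. -/
theorem Spec_eq_of_hasCrossing_of_isUnit [NeZero p] {D : Diagram} {c : D.Coloring p}
    (hc : L.IsMinimalColoring c) {a b : ZMod p} (hcr : c.HasCrossing a b (2 * b - a))
    (hu : IsUnit (b - a)) : L.Spec p = Set.Icc (L.mincol p) (L.maxcol p) := by
  obtain ⟨hD, hnt, hmin⟩ := hc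
  obtain ⟨v, hv⟩ := hu
  have hv' : (v⁻¹ : (ZMod p)ˣ) * (b - a) = (1 : ZMod p) := by rw [← hv, Units.inv_mul]
  have hinj := Diagram.Coloring.injective_affine (v⁻¹).isUnit a
  refine Spec_eq_of_hasCrossing (c := c.affine (v⁻¹ : (ZMod p)ˣ) a) ⟨hD, ?_, ?_⟩ ?_
  · rw [Diagram.Coloring.isNontrivial_iff] at hnt ⊢
    rw [Diagram.Coloring.range_affine]
    exact hnt.image hinj
  · rw [← hmin, Diagram.Coloring.numColors, Diagram.Coloring.range_affine,
      Set.ncard_image_of_injective _ hinj]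
    rfl
  · have := hcr.affine (v⁻¹ : (ZMod p)ˣ) a
    rwa [sub_self, mul_zero, hv', show (v⁻¹ : (ZMod p)ˣ) * (2 * b - a - a) = (2 : ZMod p) by
      linear_combination 2 * hv'] at this

end Link

theorem corollary8 (p : ℕ) (hp : 1 < p) (L : Link) (hL : ¬ L.IsSplit)
    (hcol : L.HasNontrivialColoring p) :
    ((∃ (D : Diagram) (c : D.Coloring p), L.IsMinimalColoring c ∧ c.HasCrossing 0 1 2) →
      L.Spec p = Set.Icc (L.mincol p) (L.maxcol p)) ∧
    ((∃ (D : Diagram) (c : D.Coloring p), L.IsMinimalColoring c ∧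
        ∃ a b : ZMod p, c.HasCrossing a b (2 * b - a) ∧ IsUnit (b - a)) →
      L.Spec p = Set.Icc (L.mincol p) (L.maxcol p)) := by
  have : NeZero p := ⟨by omega⟩
  constructor
  · rintro ⟨D, c, hc, hcr⟩
    exact Link.Spec_eq_of_hasCrossing hc hcr
  · rintro ⟨D, c, hc, a, b, hcr, hu⟩
    exact Link.Spec_eq_of_hasCrossing_of_isUnit hc hcr hu
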